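/- \textbf{Setting.} Let $X=(X_n)_{n\ge 0}$ be a homogeneous Markov process with Markov kernel $\Pi$ on a measurable state space $E$, with $\mathbb P_x$, $\mathbb E_x$ denoting probability and expectation when $X_0=x$; let $0<\alpha<1$ and let $f,g,h:E\to\mathbb R$ be measurable. Let $(\xi^{(i)}_n)_{n\ge0}$, $i=1,2$, be iid sequences of $U(0,1)$ random variables, independent of each other and of $X$. Let $\tilde X$ be $X$ killed independently at each time $n\ge 1$ with probability $1-\alpha$ (that is, sent to a cemetery state where it remains and where all functions vanish), and assume that $\sup_{n}|f(\tilde X_n)|$, $\sup_n|g(\tilde X_n)|$ and $\sup_n|h(\tilde X_n)|$ are integrable under every $\mathbb P_x$. In the zero-sum Dynkin game, player $i\in\{1,2\}$ chooses an element $\tau_i$ of the set $\mathcal T_i$ of all $\{0,1,2,\dots,\infty\}$-valued stopping times of the filtration $\sigma(X_0,\dots,X_n,\xi^{(i)}_0,\dots,\xi^{(i)}_n)$, $n\ge0$. Player 1 maximizes and player 2 minimizes $$J(x;\tau_1,\tau_2)=\mathbb E_x\big[\alpha^{\tau_1}f(X_{\tau_1})\mathbb I_{\{\tau_1<\tau_2\}}+\alpha^{\tau_2}g(X_{\tau_2})\mathbb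 I_{\{\tau_2<\tau_1\}}+\alpha^{\tau_1}h(X_{\tau_1})\mathbb I_{\{\tau_1=\tau_2<\infty\}}\big].$$ A pair of measurable functions $p^{(1)},p^{(2)}:E\to[0,1]$ is a \emph{global Markovian equilibrium} if, with $\tau^{p^{(i)}}=\inf\{n\ge0: p^{(i)}(X_n)\ge\xi^{(i)}_n\}$ (and $\inf\emptyset=\infty$), for every $x\in E$, $$\sup_{\tau_1\in\mathcal T_1}J(x;\tau_1,\tau^{p^{(2)}})=J(x;\tau^{p^{(1)}},\tau^{p^{(2)}})=\inf_{\tau_2\in\mathcal T_2}J(x;\tau^{p^{(1)}},\tau_2);$$ its value function is $V(x)=J(x;\tau^{p^{(1)}},\tau^{p^{(2)}})$. It is \emph{pure} if $p^{(1)}$ and $p^{(2)}$ take values in $\{0,1\}$. Write $\Pi V(x)=\int_E V(y)\,\Pi(x,dy)$, $a\vee b=\max\{a,b\}$ and $a\wedge b=\min\{a,b\}$. \textbf{Theorem.} Suppose that a global Markovian equilibrium exists and let $V$ be its value function. Then a pure global Markovian equilibrium exists if and only if, for all $x\in E$, $$h(x)\vee\alpha\Pi V(x)\ \ge\ f(x)\wedge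 g(x)\quad\text{and}\quad h(x)\wedge\alpha\Pi V(x)\ \le\ f(x)\vee g(x).$$ -/

import Mathlib

open MeasureTheory ProbabilityTheory

namespace DynkinGame

/-- The `σ`-algebra `σ(X₀, …, Xₙ)` on `Ω` generated by a process up to time `n`. -/
def pathHistory {E Ω : Type*} [MeasurableSpace E] (X : ℕ → Ω → E) (n : ℕ) : MeasurableSpace Ω :=
  ⨆ k : ℕ, ⨆ _ : k ≤ n, MeasurableSpace.comap (X k) inferInstance

/-- The probabilistic setting of a discounted Markovian Dynkin game in discrete time: a discount
factor `α ∈ (0,1)`, a Markov kernel `kernel` on the state space `E`, and a measurable space `Ω`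
with probability measures `P x`, `x ∈ E`, supporting

* a homogeneous Markov process `X` with transition kernel `kernel`, started at `x` under `P x`;
* for each of the two players an iid sequence `ξ i` of `U(0,1)` randomization devices (player 1 is
  the index `0`, player 2 is the index `1`);
* iid killing coins `kill n`, showing `true` with probability `1 - α`;

where the process `X`, the two sequences `ξ 0`, `ξ 1`, and the coins are independent. -/
structure Model (E Ω : Type*) [MeasurableSpace E] [MeasurableSpace Ω] where
  α : ℝ
  α_pos : 0 < α
  α_lt_one : α < 1
  kernel : Kernel E E
  isMarkovKernel : IsMarkovKernel kernel
  P : E → Measure Ω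
  isProbabilityMeasure : ∀ x, IsProbabilityMeasure (P x)
  X : ℕ → Ω → E
  measurable_X : ∀ n, Measurable (X n)
  /-- Under `P x` the process starts at `x`. -/
  law_X_zero : ∀ x, (P x).map (X 0) = Measure.dirac x
  /-- The Markov property: `P x (X (n+1) ∈ A | X 0, …, X n) = kernel (X n) A` almost surely. -/
  markov : ∀ (x : E) (n : ℕ) (A : Set E), MeasurableSet A →
    (P x)[(X (n + 1) ⁻¹' A).indicator (fun _ => (1 : ℝ)) | pathHistory X n]
      =ᵐ[P x] fun ω => (kernel (X n ω)).real A
  ξ : Fin 2 → ℕ → Ω → ℝ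
  measurable_ξ : ∀ i n, Measurable (ξ i n)
  law_ξ : ∀ x i n, (P x).map (ξ i n) = volume.restrict (Set.Ioo (0 : ℝ) 1)
  indep_ξ : ∀ x, iIndepFun (fun (k : Fin 2 × ℕ) => ξ k.1 k.2) (P x)
  indep_X_ξ : ∀ x, IndepFun (fun ω (n : ℕ) => X n ω) (fun ω (k : Fin 2 × ℕ) => ξ k.1 k.2 ω) (P x)
  kill : ℕ → Ω → Bool
  measurable_kill : ∀ n, Measurable (kill n)
  law_kill : ∀ x n, P x {ω | kill n ω = true} = ENNReal.ofReal (1 - α)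
  indep_kill : ∀ x, iIndepFun kill (P x)
  indep_X_ξ_kill : ∀ x,
    IndepFun (fun ω => ((fun (n : ℕ) => X n ω), fun (k : Fin 2 × ℕ) => ξ k.1 k.2 ω))
      (fun ω (n : ℕ) => kill n ω) (P x)

/-- The payoff functions of the two players (indices `0` and `1`): `f i` is received if player `i`
stops first, `g i` if the opponent stops first, `h i` if both stop simultaneously. -/
structure Payoffs (E : Type*) [MeasurableSpace E] where
  f : Fin 2 → E → ℝ
  g : Fin 2 → E → ℝ
  h : Fin 2 → E → ℝ

/-- The zero-sum game: `f₁ = f`, `g₁ = g`, `h₁ = h`, `f₂ = -g`, `g₂ = -f`, `h₂ = -h`. -/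
def zeroSum {E : Type*} [MeasurableSpace E] (f g h : E → ℝ) : Payoffs E where
  f := ![f, -g]
  g := ![g, -f]
  h := ![h, -h]

/-- A Markovian randomized stopping strategy: a measurable function `E → [0,1]`. -/
structure Strategy (E : Type*) [MeasurableSpace E] where
  toFun : E → ℝ
  measurable_toFun : Measurable toFun
  mem_Icc : ∀ x, toFun x ∈ Set.Icc (0 : ℝ) 1

/-- A strategy is pure if it takes only the values `0` and `1`. -/
def Strategy.IsPure {E : Type*} [MeasurableSpace E] (p : Strategy E) : Prop :=
  ∀ x, p.toFun x = 0 ∨ p.toFun x = 1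

namespace Model

variable {E Ω : Type*} [MeasurableSpace E] [MeasurableSpace Ω]

/-- The killed process: `X` is sent to the cemetery state `none` at each time `n ≥ 1` with
probability `1 - α`, and stays there. -/
def killed (D : Model E Ω) : ℕ → Ω → Option E
  | 0, ω => some (D.X 0 ω)
  | n + 1, ω =>
    match D.killed n ω with
    | none => none
    | some _ => if D.kill (n + 1) ω then none else some (D.X (n + 1) ω)

/-- `sup_n |u (X̃ n)| ∈ L¹` under every `P x`, where `X̃` is the killed process and `u` takes the
value `0` in the cemetery. -/
def SupIntegrable (D : Model E Ω) (u : E → ℝ) : Prop :=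
  ∀ x, ∫⁻ ω, ⨆ n : ℕ, ‖(D.killed n ω).elim 0 u‖ₑ ∂(D.P x) < ⊤

/-- The standing assumptions on the payoff functions: measurability, and integrability of the
running suprema along the killed process. -/
structure Standing (D : Model E Ω) (G : Payoffs E) : Prop where
  measurable_f : ∀ i, Measurable (G.f i)
  measurable_g : ∀ i, Measurable (G.g i)
  measurable_h : ∀ i, Measurable (G.h i)
  integrable_f : ∀ i, D.SupIntegrable (G.f i)
  integrable_g : ∀ i, D.SupIntegrable (G.g i)
  integrable_h : ∀ i, D.SupIntegrable (G.h i)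

/-- The filtration `σ(X₀, …, Xₙ, ξⁱ₀, …, ξⁱₙ)` of player `i`. -/
def filtration (D : Model E Ω) (i : Fin 2) : Filtration ℕ (inferInstance : MeasurableSpace Ω) where
  seq n := pathHistory D.X n ⊔ pathHistory (D.ξ i) n
  mono' m n hmn := sup_le_sup
    (iSup_mono fun _ => iSup_mono' fun hk => ⟨hk.trans hmn, le_rfl⟩)
    (iSup_mono fun _ => iSup_mono' fun hk => ⟨hk.trans hmn, le_rfl⟩)
  le' _ := sup_le
    (iSup_le fun k => iSup_le fun _ => (D.measurable_X k).comap_le)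
    (iSup_le fun k => iSup_le fun _ => (D.measurable_ξ i k).comap_le)

/-- The admissible stopping times of player `i`; the value `⊤` (never stopping) is allowed. -/
def admissible (D : Model E Ω) (i : Fin 2) : Set (Ω → WithTop ℕ) :=
  {τ | IsStoppingTime (D.filtration i) τ}

open Classical in
/-- The Markovian randomized stopping time `inf {n : p (X n) ≥ ξⁱ n}` of player `i`, with
`inf ∅ = ∞`. -/
noncomputable def markovTime (D : Model E Ω) (i : Fin 2) (p : Strategy E) (ω : Ω) : WithTop ℕ :=
  if H : ∃ n : ℕ, D.ξ i n ω ≤ p.toFun (D.X n ω) then ((Nat.find H : ℕ) : WithTop ℕ) else ⊤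

/-- The realized discounted reward of a player who stops at `τ` while the opponent stops at `σ`. -/
noncomputable def reward (D : Model E Ω) (f g h : E → ℝ) (τ σ : Ω → WithTop ℕ) (ω : Ω) : ℝ :=
  if τ ω < σ ω then D.α ^ (τ ω).untopD 0 * f (D.X ((τ ω).untopD 0) ω)
  else if σ ω < τ ω then D.α ^ (σ ω).untopD 0 * g (D.X ((σ ω).untopD 0) ω)
  else if τ ω < ⊤ then D.α ^ (τ ω).untopD 0 * h (D.X ((τ ω).untopD 0) ω)
  else 0

/-- The expected reward `J₁(x; τ₁, τ₂)` of player 1. -/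
noncomputable def J₁ (D : Model E Ω) (G : Payoffs E) (x : E) (τ₁ τ₂ : Ω → WithTop ℕ) : ℝ :=
  ∫ ω, D.reward (G.f 0) (G.g 0) (G.h 0) τ₁ τ₂ ω ∂(D.P x)

/-- The expected reward `J₂(x; τ₁, τ₂)` of player 2. -/
noncomputable def J₂ (D : Model E Ω) (G : Payoffs E) (x : E) (τ₁ τ₂ : Ω → WithTop ℕ) : ℝ :=
  ∫ ω, D.reward (G.f 1) (G.g 1) (G.h 1) τ₂ τ₁ ω ∂(D.P x)

/-- `(τ₁, τ₂)` is a Nash equilibrium for the initial state `x`. -/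
structure IsNash (D : Model E Ω) (G : Payoffs E) (x : E) (τ₁ τ₂ : Ω → WithTop ℕ) : Prop where
  admissible₁ : τ₁ ∈ D.admissible 0
  admissible₂ : τ₂ ∈ D.admissible 1
  optimal₁ : IsLUB ((fun σ => D.J₁ G x σ τ₂) '' D.admissible 0) (D.J₁ G x τ₁ τ₂)
  optimal₂ : IsLUB ((fun σ => D.J₂ G x τ₁ σ) '' D.admissible 1) (D.J₂ G x τ₁ τ₂)

/-- `(p₁, p₂)` is a global Markovian (randomized) equilibrium: the associated stopping times are a
Nash equilibrium for every initial state. -/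
def IsGlobalEquilibrium (D : Model E Ω) (G : Payoffs E) (p₁ p₂ : Strategy E) : Prop :=
  ∀ x, D.IsNash G x (D.markovTime 0 p₁) (D.markovTime 1 p₂)

/-- The equilibrium value `V(x) = J₁(x; τ^{p₁}, τ^{p₂})` (for player 1). -/
noncomputable def value (D : Model E Ω) (G : Payoffs E) (p₁ p₂ : Strategy E) (x : E) : ℝ :=
  D.J₁ G x (D.markovTime 0 p₁) (D.markovTime 1 p₂)

/-- The discounted continuation value `α Π V (x)`. -/
noncomputable def continuation (D : Model E Ω) (V : E → ℝ) (x : E) : ℝ :=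
  D.α * ∫ y, V y ∂(D.kernel x)

end Model

end DynkinGame

/-! At a state x the players face a 2 × 2 matrix game: both stop (h), only player 1 stops (f), only
player 2 stops (g), or both continue, which is worth c = αΠV. The two inequalities say exactly that
neither diagonal of this matrix lies strictly above the other, that is, that the matrix has a saddle
point in pure strategies. So the theorem claims that pure equilibria exist globally iff all these
one-shot games have pure solutions.

Linking the two levels takes two facts. (1) In an equilibrium, p₁(x) and p₂(x) are optimal in the
matrix game at x, whose value is V(x): a player may deviate at time 0 only, and the reward is then
the matrix payoff (`integral_reward_eq_matrixGame`). (2) Conversely, if stopping on S and on T is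
optimal in every matrix game with continuation value αΠV, then these sets form an equilibrium
(`isGlobalEquilibrium_ofSet`). This is a supermartingale argument (`integral_reward_le`), closed by
αⁿ E[V(Xₙ)] → 0.

Necessity: all equilibria of a zero-sum game share one value (`value_eq`), so a pure equilibrium
gives a pure saddle point of the matrix built from the given V. Sufficiency: mixed optimal actions
of value V(x) in a matrix with a pure saddle point can be replaced by pure ones (`exists_pure_row`),
and the states where stopping is such a choice form measurable sets.

All integrability comes from one estimate: the payoffs have a finite discounted potential ∑ αⁿΠⁿ|u|,
and V is bounded by that potential. The Markov property is used relative to the path and all devices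
of both players, past and future. Since X is independent of the devices this costs nothing, and
against an opponent who does not randomize the extra information gives no advantage. -/

open Filter
open scoped ENNReal Topology

namespace DynkinGame

namespace Model

variable {E Ω : Type*} [MeasurableSpace E] [MeasurableSpace Ω]

attribute [instance] Model.isProbabilityMeasure Model.isMarkovKernel

/-! ### The Markov property in the presence of the randomization devices -/

/-- The path stopped at time `n`, together with all randomization devices. -/
def history (D : Model E Ω) (n : ℕ) (ω : Ω) : (ℕ → E) × (Fin 2 × ℕ → ℝ) :=
  (fun k => D.X (min k n) ω, fun k => D.ξ k.1 k.2 ω)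

theorem measurable_history (D : Model E Ω) (n : ℕ) : Measurable (D.history n) :=
  (measurable_pi_lambda _ fun _ => D.measurable_X _).prodMk
    (measurable_pi_lambda _ fun _ => D.measurable_ξ _ _)

theorem measurable_path (D : Model E Ω) : Measurable fun ω (n : ℕ) => D.X n ω :=
  measurable_pi_lambda _ fun _ => D.measurable_X _

theorem measurable_devices (D : Model E Ω) :
    Measurable fun ω (k : Fin 2 × ℕ) => D.ξ k.1 k.2 ω :=
  measurable_pi_lambda _ fun _ => D.measurable_ξ _ _

/-- The filtration `σ(X₀, …, Xₙ) ∨ σ(ξ)`. -/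
def fullFiltration (D : Model E Ω) : Filtration ℕ (inferInstance : MeasurableSpace Ω) where
  seq n := MeasurableSpace.comap (D.history n) inferInstance
  mono' m n hmn := by
    have : D.history m = (fun y : (ℕ → E) × (Fin 2 × ℕ → ℝ) =>
        (((fun k => y.1 (min k m)) : ℕ → E), y.2)) ∘ D.history n := by
      funext ω
      simp only [history, Function.comp, Prod.mk.injEq, and_true]
      funext k
      rw [min_assoc, min_eq_left hmn]
    change MeasurableSpace.comap _ _ ≤ _
    rw [this, ← MeasurableSpace.comap_comp]
    exact MeasurableSpace.comap_mono (Measurable.comap_le (by fun_prop))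
  le' n := (D.measurable_history n).comap_le

theorem measurable_X_fullFiltration (D : Model E Ω) {k n : ℕ} (h : k ≤ n) :
    Measurable[D.fullFiltration n] (D.X k) := by
  have : D.X k = (fun y : (ℕ → E) × (Fin 2 × ℕ → ℝ) => y.1 k) ∘ D.history n := by
    funext ω; simp [history, min_eq_left h]
  rw [this]
  exact Measurable.comp (by fun_prop) (comap_measurable _)

theorem measurable_ξ_fullFiltration (D : Model E Ω) (i : Fin 2) (k n : ℕ) :
    Measurable[D.fullFiltration n] (D.ξ i k) := by
  have : D.ξ i k = (fun y : (ℕ → E) × (Fin 2 × ℕ → ℝ) => y.2 (i, k)) ∘ D.history n := by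
    funext ω; simp [history]
  rw [this]
  exact Measurable.comp (by fun_prop) (comap_measurable _)

theorem filtration_le_fullFiltration (D : Model E Ω) (i : Fin 2) (n : ℕ) :
    D.filtration i n ≤ D.fullFiltration n :=
  sup_le (iSup_le fun _ => iSup_le fun h => (D.measurable_X_fullFiltration h).comap_le)
    (iSup_le fun k => iSup_le fun _ => (D.measurable_ξ_fullFiltration i k n).comap_le)

theorem measurable_X_pathHistory (D : Model E Ω) {k n : ℕ} (h : k ≤ n) :
    Measurable[pathHistory D.X n] (D.X k) :=
  Measurable.of_comap_le (le_iSup₂_of_le (f := fun k (_ : k ≤ n) =>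
    MeasurableSpace.comap (D.X k) inferInstance) k h le_rfl)

theorem pathHistory_le (D : Model E Ω) (n : ℕ) :
    pathHistory D.X n ≤ (inferInstance : MeasurableSpace Ω) :=
  iSup_le fun k => iSup_le fun _ => (D.measurable_X k).comap_le

theorem lintegral_kernel_of_pathHistory (D : Model E Ω) (x : E) (n : ℕ) {A : Set Ω}
    (hA : MeasurableSet[pathHistory D.X n] A) {B : Set E} (hB : MeasurableSet B) :
    ∫⁻ ω in A, D.kernel (D.X n ω) B ∂(D.P x) = D.P x (D.X (n + 1) ⁻¹' B ∩ A) := by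
  have hB' := D.measurable_X (n + 1) hB
  have hm := D.pathHistory_le n
  have h1 : ∫ ω in A, (D.kernel (D.X n ω)).real B ∂(D.P x)
      = (D.P x).real (D.X (n + 1) ⁻¹' B ∩ A) := by
    rw [← setIntegral_congr_ae (g := fun ω => (D.kernel (D.X n ω)).real B) (hm _ hA)
      ((D.markov x n B hB).mono fun ω h _ => h),
      setIntegral_condExp hm ((integrable_const _).indicator hB') hA, integral_indicator hB']
    simp [measureReal_restrict_apply, hB']
  have hk : Measurable fun ω => D.kernel (D.X n ω) B :=
    (D.kernel.measurable_coe hB).comp (D.measurable_X n)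
  simp only [measureReal_def] at h1
  rw [integral_toReal hk.aemeasurable (by simp)] at h1
  refine (ENNReal.toReal_eq_toReal_iff' ?_ (measure_ne_top _ _)).1 h1
  refine ne_top_of_le_ne_top (b := D.P x A) (measure_ne_top _ _) ?_
  calc _ ≤ ∫⁻ ω in A, 1 ∂(D.P x) := lintegral_mono fun ω => prob_le_one
    _ = _ := by simp

/-- The devices are independent of the whole path, so conditioning on them does not change the
one-step transition law. -/
theorem map_X_succ_restrict (D : Model E Ω) (x : E) (n : ℕ) {A : Set Ω}
    (hA : MeasurableSet[D.fullFiltration n] A) :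
    ((D.P x).restrict A).map (D.X (n + 1)) = D.kernel ∘ₘ ((D.P x).restrict A).map (D.X n) := by
  obtain ⟨S, hS, rfl⟩ := hA
  refine Measure.ext fun B hB => ?_
  have hB' := D.measurable_X (n + 1) hB
  have hk : Measurable fun y => D.kernel y B := D.kernel.measurable_coe hB
  rw [Measure.map_apply (D.measurable_X _) hB, Measure.bind_apply hB (Kernel.aemeasurable _),
    lintegral_map hk (D.measurable_X n), Measure.restrict_apply hB', Set.inter_comm]
  -- As an equality of finite measures on (path, devices), the claim need only be tested on
  -- rectangles. There independence splits off the devices and the Markov property handles the path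
  -- factor.
  suffices h : ((D.P x).restrict (D.X (n + 1) ⁻¹' B)).map (D.history n)
      = ((D.P x).withDensity fun ω => D.kernel (D.X n ω) B).map (D.history n) by
    have := congrArg (fun μ => μ S) h
    simp only [Measure.map_apply (D.measurable_history n) hS] at this
    rwa [Measure.restrict_apply (D.measurable_history n hS),
      withDensity_apply _ (D.measurable_history n hS)] at this
  have hk1 : ∫⁻ ω, D.kernel (D.X n ω) B ∂(D.P x) ≠ ∞ := by
    refine ne_top_of_le_ne_top (b := 1) ENNReal.one_ne_top ?_
    calc _ ≤ ∫⁻ ω, 1 ∂(D.P x) := lintegral_mono fun ω => prob_le_one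
      _ = _ := by simp
  have : IsFiniteMeasure ((D.P x).withDensity fun ω => D.kernel (D.X n ω) B) :=
    isFiniteMeasure_withDensity hk1
  refine Measure.ext_prod fun {s t} hs ht => ?_
  rw [Measure.map_apply (D.measurable_history n) (hs.prod ht),
    Measure.map_apply (D.measurable_history n) (hs.prod ht),
    Measure.restrict_apply (D.measurable_history n (hs.prod ht)),
    withDensity_apply _ (D.measurable_history n (hs.prod ht))]
  set φ : (ℕ → E) → (ℕ → E) := fun y k => y (min k n) with hφ
  have hφm : Measurable φ := by fun_prop
  set XX : Ω → (ℕ → E) := fun ω m => D.X m ω with hXX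
  set Z : Ω → (Fin 2 × ℕ → ℝ) := fun ω k => D.ξ k.1 k.2 ω with hZ
  have hpre : D.history n ⁻¹' s ×ˢ t = (XX ⁻¹' (φ ⁻¹' s)) ∩ Z ⁻¹' t := rfl
  have hXm : Measurable XX := D.measurable_path
  have hZm : Measurable Z := D.measurable_devices
  have hAp : MeasurableSet[pathHistory D.X n] (XX ⁻¹' (φ ⁻¹' s)) := by
    have : @Measurable _ _ (pathHistory D.X n) _ (fun ω => φ (XX ω)) :=
      @measurable_pi_lambda _ _ _ (pathHistory D.X n) _ _
        fun k => D.measurable_X_pathHistory (min_le_right k n)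
    exact this hs
  have hind := D.indep_X_ξ x
  rw [hpre]
  have e1 : XX ⁻¹' (φ ⁻¹' s) ∩ Z ⁻¹' t ∩ D.X (n + 1) ⁻¹' B
      = XX ⁻¹' (φ ⁻¹' s ∩ {y | y (n + 1) ∈ B}) ∩ Z ⁻¹' t := by
    ext ω; simp only [Set.mem_inter_iff, Set.mem_preimage, Set.mem_ofPred_eq, hXX]; tauto
  have hBm : MeasurableSet {y : ℕ → E | y (n + 1) ∈ B} := measurable_pi_apply (n + 1) hB
  rw [e1, hind.measure_inter_preimage_eq_mul _ _ ((hφm hs).inter hBm) ht]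
  have e2 : XX ⁻¹' (φ ⁻¹' s ∩ {y | y (n + 1) ∈ B})
      = D.X (n + 1) ⁻¹' B ∩ XX ⁻¹' (φ ⁻¹' s) := by
    ext ω; simp only [Set.mem_inter_iff, Set.mem_preimage, Set.mem_ofPred_eq, hXX]; tauto
  rw [e2, ← D.lintegral_kernel_of_pathHistory x n hAp hB]
  have hm1 : Measurable ((φ ⁻¹' s).indicator fun y : ℕ → E => D.kernel (y n) B) :=
    (hk.comp (measurable_pi_apply n)).indicator (hφm hs)
  have hm2 : Measurable (t.indicator fun _ : Fin 2 × ℕ → ℝ => (1 : ℝ≥0∞)) :=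
    measurable_const.indicator ht
  have key := lintegral_mul_eq_lintegral_mul_lintegral_of_indepFun (hm1.comp hXm) (hm2.comp hZm)
    (hind.comp hm1 hm2)
  rw [← lintegral_indicator (hXm (hφm hs)), ← lintegral_indicator ((hXm (hφm hs)).inter (hZm ht)),
    ← lintegral_indicator_one (hZm ht)]
  refine Eq.trans ?_ (key.symm.trans ?_)
  · rfl
  · refine lintegral_congr fun ω => ?_
    have := Set.inter_indicator_mul (s := XX ⁻¹' (φ ⁻¹' s)) (t := Z ⁻¹' t)
      (fun ω => D.kernel (D.X n ω) B) (fun _ => 1) ω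
    simp only [mul_one] at this
    exact this.symm

theorem setLIntegral_X_succ (D : Model E Ω) (x : E) (n : ℕ) {A : Set Ω}
    (hA : MeasurableSet[D.fullFiltration n] A) {u : E → ℝ≥0∞} (hu : Measurable u) :
    ∫⁻ ω in A, u (D.X (n + 1) ω) ∂(D.P x)
      = ∫⁻ ω in A, ∫⁻ y, u y ∂(D.kernel (D.X n ω)) ∂(D.P x) := by
  rw [← lintegral_map hu (D.measurable_X _), D.map_X_succ_restrict x n hA,
    Measure.lintegral_bind (Kernel.aemeasurable _) hu.aemeasurable,
    lintegral_map hu.lintegral_kernel (D.measurable_X n)]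

theorem setIntegral_X_succ (D : Model E Ω) (x : E) (n : ℕ) {A : Set Ω}
    (hA : MeasurableSet[D.fullFiltration n] A) {u : E → ℝ} (hu : Measurable u)
    (hi : Integrable (fun ω => u (D.X (n + 1) ω)) (D.P x)) :
    ∫ ω in A, u (D.X (n + 1) ω) ∂(D.P x)
      = ∫ ω in A, ∫ y, u y ∂(D.kernel (D.X n ω)) ∂(D.P x) := by
  have hi' : Integrable u (((D.P x).restrict A).map (D.X (n + 1))) :=
    (integrable_map_measure hu.aestronglyMeasurable (D.measurable_X _).aemeasurable).2
      hi.integrableOn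
  rw [← integral_map (D.measurable_X _).aemeasurable hu.aestronglyMeasurable,
    D.map_X_succ_restrict x n hA]
  rw [D.map_X_succ_restrict x n hA] at hi'
  -- The measure is viewed as a constant kernel so that the composition formula for Bochner
  -- integrals applies.
  have hc : (D.kernel ∘ₖ Kernel.const Unit (((D.P x).restrict A).map (D.X n))) ()
      = D.kernel ∘ₘ ((D.P x).restrict A).map (D.X n) := Kernel.comp_apply _ _ _
  rw [← hc] at hi' ⊢
  rw [Kernel.integral_comp hi', Kernel.const_apply, integral_map (D.measurable_X _).aemeasurable]
  exact hu.stronglyMeasurable.integral_kernel.aestronglyMeasurable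

/-! ### Potentials and the killed process -/

theorem lintegral_X_zero (D : Model E Ω) (x : E) {u : E → ℝ≥0∞} (hu : Measurable u) :
    ∫⁻ ω, u (D.X 0 ω) ∂(D.P x) = u x := by
  rw [← lintegral_map hu (D.measurable_X 0), D.law_X_zero, lintegral_dirac' _ hu]

theorem ae_X_zero (D : Model E Ω) (x : E) {u : E → ℝ} (hu : Measurable u) :
    ∀ᵐ ω ∂(D.P x), u (D.X 0 ω) = u x := by
  have hs : MeasurableSet {y | u y = u x} := hu (measurableSet_singleton (u x))
  have : ∀ᵐ y ∂((D.P x).map (D.X 0)), u y = u x := by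
    rw [D.law_X_zero, ae_dirac_iff hs]
  exact (ae_map_iff (D.measurable_X 0).aemeasurable hs).1 this

/-- The transition operator `u ↦ Πu` on nonnegative functions. -/
noncomputable def transition (D : Model E Ω) (u : E → ℝ≥0∞) (x : E) : ℝ≥0∞ :=
  ∫⁻ y, u y ∂(D.kernel x)

theorem measurable_transition (D : Model E Ω) {u : E → ℝ≥0∞} (hu : Measurable u) :
    Measurable (D.transition u) :=
  hu.lintegral_kernel

theorem measurable_transition_iterate (D : Model E Ω) {u : E → ℝ≥0∞} (hu : Measurable u) (n : ℕ) :
    Measurable (D.transition^[n] u) := by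
  induction n generalizing u with
  | zero => exact hu
  | succ n ih => exact ih (D.measurable_transition hu)

theorem lintegral_X (D : Model E Ω) (x : E) (n : ℕ) {u : E → ℝ≥0∞} (hu : Measurable u) :
    ∫⁻ ω, u (D.X n ω) ∂(D.P x) = D.transition^[n] u x := by
  induction n generalizing u with
  | zero => exact D.lintegral_X_zero x hu
  | succ n ih =>
    have := D.setLIntegral_X_succ x n (A := Set.univ) MeasurableSet.univ hu
    rw [Measure.restrict_univ] at this
    rw [this, Function.iterate_succ_apply, ← ih (D.measurable_transition hu)]
    rfl

/-- The discounted potential `∑ αⁿ Πⁿ u`. -/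
noncomputable def potential (D : Model E Ω) (u : E → ℝ≥0∞) (x : E) : ℝ≥0∞ :=
  ∑' n, ENNReal.ofReal D.α ^ n * D.transition^[n] u x

theorem measurable_potential (D : Model E Ω) {u : E → ℝ≥0∞} (hu : Measurable u) :
    Measurable (D.potential u) :=
  Measurable.tsum fun n => (D.measurable_transition_iterate hu n).const_mul _

/-- The right side is the tail from index n of the series defining the potential at x. Hence these
quantities are finite and tend to 0 whenever the potential is finite. -/
theorem lintegral_potential_X (D : Model E Ω) (x : E) (n : ℕ) {u : E → ℝ≥0∞} (hu : Measurable u) :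
    ENNReal.ofReal D.α ^ n * ∫⁻ ω, D.potential u (D.X n ω) ∂(D.P x)
      = ∑' m, ENNReal.ofReal D.α ^ (m + n) * D.transition^[m + n] u x := by
  simp only [potential]
  rw [lintegral_tsum (f := fun m ω => ENNReal.ofReal D.α ^ m * D.transition^[m] u (D.X n ω))
    fun m => (((D.measurable_transition_iterate hu m).comp
    (D.measurable_X n)).const_mul _).aemeasurable, ← ENNReal.tsum_mul_left]
  refine tsum_congr fun m => ?_
  rw [lintegral_const_mul (f := fun ω => D.transition^[m] u (D.X n ω)) _
      ((D.measurable_transition_iterate hu m).comp (D.measurable_X n)),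
    D.lintegral_X x n (D.measurable_transition_iterate hu m), add_comm m n,
    Function.iterate_add_apply, pow_add, mul_assoc]

theorem lintegral_potential_X_ne_top (D : Model E Ω) (x : E) (n : ℕ) {u : E → ℝ≥0∞}
    (hu : Measurable u) (hx : D.potential u x ≠ ∞) :
    ENNReal.ofReal D.α ^ n * ∫⁻ ω, D.potential u (D.X n ω) ∂(D.P x) ≠ ∞ := by
  rw [D.lintegral_potential_X x n hu]
  exact ne_top_of_le_ne_top hx (ENNReal.tsum_comp_le_tsum_of_injective (add_left_injective n)
    (fun m => ENNReal.ofReal D.α ^ m * D.transition^[m] u x))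

theorem tendsto_lintegral_potential_X (D : Model E Ω) (x : E) {u : E → ℝ≥0∞}
    (hu : Measurable u) (hx : D.potential u x ≠ ∞) :
    Tendsto (fun n => ENNReal.ofReal D.α ^ n * ∫⁻ ω, D.potential u (D.X n ω) ∂(D.P x))
      atTop (𝓝 0) := by
  simp only [D.lintegral_potential_X x _ hu]
  exact ENNReal.tendsto_sum_nat_add (fun m => ENNReal.ofReal D.α ^ m * D.transition^[m] u x) hx

/-- Splitting off the term n = 0. Thus the potential of F dominates both F and αΠ of itself, which
makes it a bound that survives Bellman steps. -/
theorem potential_eq (D : Model E Ω) {u : E → ℝ≥0∞} (hu : Measurable u) (x : E) :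
    D.potential u x = u x + ENNReal.ofReal D.α * D.transition (D.potential u) x := by
  have h := D.lintegral_potential_X x 1 hu
  rw [D.lintegral_X x 1 (D.measurable_potential hu), pow_one, Function.iterate_one] at h
  rw [h, potential, tsum_eq_zero_add' ENNReal.summable]
  simp

/-- The event says that n is the last time alive. The coin of time 0 is never used, hence the shift
by one. -/
theorem measure_last_alive (D : Model E Ω) (x : E) (n : ℕ) :
    D.P x ((fun ω (m : ℕ) => D.kill m ω) ⁻¹'
        {c | (∀ k < n, c (k + 1) = false) ∧ c (n + 1) = true})
      = ENNReal.ofReal D.α ^ n * ENNReal.ofReal (1 - D.α) := by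
  have hind : iIndepFun (fun k => D.kill (k + 1)) (D.P x) :=
    (D.indep_kill x).precomp (add_left_injective 1)
  have hfalse : ∀ k, D.P x (D.kill k ⁻¹' {false}) = ENNReal.ofReal D.α := by
    intro k
    have e : D.kill k ⁻¹' {false} = {ω | D.kill k ω = true}ᶜ := by
      ext ω; simp
    have hm : MeasurableSet {ω | D.kill k ω = true} :=
      D.measurable_kill k (measurableSet_singleton true)
    rw [e, prob_compl_eq_one_sub hm, D.law_kill, ← ENNReal.ofReal_one,
      ← ENNReal.ofReal_sub _ (by linarith [D.α_lt_one])]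
    congr 1; ring
  have := hind.measure_inter_preimage_eq_mul (Finset.range (n + 1))
    (sets := fun k => if k = n then {true} else {false}) (fun k _ => MeasurableSet.of_discrete)
  rw [Finset.prod_range_succ, Finset.prod_congr rfl
    (g := fun _ => ENNReal.ofReal D.α)] at this
  · simp only [Finset.prod_const, Finset.card_range, if_true] at this
    rw [show D.P x (D.kill (n + 1) ⁻¹' {true}) = _ from D.law_kill x (n + 1)] at this
    rw [← this]
    congr 1
    ext ω
    simp only [Set.mem_preimage, Set.mem_ofPred_eq, Set.mem_iInter, Finset.mem_range,
      Order.lt_add_one_iff]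
    constructor
    · rintro ⟨h1, h2⟩ k hk
      rcases hk.lt_or_eq with h | rfl
      · simp [h.ne, h1 k h]
      · simp [h2]
    · intro h
      refine ⟨fun k hk => ?_, ?_⟩
      · simpa [hk.ne] using h k hk.le
      · simpa using h n le_rfl
  · intro k hk
    rw [if_neg (Finset.mem_range.1 hk).ne, hfalse]

theorem killed_eq_some (D : Model E Ω) {n : ℕ} {ω : Ω}
    (h : ∀ k < n, D.kill (k + 1) ω = false) : D.killed n ω = some (D.X n ω) := by
  induction n with
  | zero => rfl
  | succ n ih => simp [killed, ih fun k hk => h k (hk.trans (Nat.lt_succ_self n)), h n]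

/-- At its last living time L the killed process satisfies |u(X_L)| ≤ supₙ |u(X̃ₙ)|. As L is
geometric and independent of X, the expectation of the left side is (1 - α) times the potential. -/
theorem SupIntegrable.potential_ne_top {D : Model E Ω} {u : E → ℝ} (hu : D.SupIntegrable u)
    (hm : Measurable u) (x : E) : D.potential (fun y => ‖u y‖ₑ) x ≠ ∞ := by
  set K : ℕ → Set (ℕ → Bool) := fun n => {c | (∀ k < n, c (k + 1) = false) ∧ c (n + 1) = true}
    with hK
  have hKm : ∀ n, MeasurableSet (K n) := by
    intro n
    have hs : ∀ k b, MeasurableSet {c : ℕ → Bool | c k = b} := fun k b =>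
      (measurable_pi_apply k : Measurable fun c : ℕ → Bool => c k) (measurableSet_singleton b)
    have e : K n = (⋂ k, ⋂ (_ : k < n), {c | c (k + 1) = false}) ∩ {c | c (n + 1) = true} := by
      ext; simp [hK]
    rw [e]
    exact (MeasurableSet.iInter fun k => MeasurableSet.iInter fun _ => hs _ _).inter (hs _ _)
  set c : Ω → ℕ → Bool := fun ω m => D.kill m ω
  have hcm : Measurable c := measurable_pi_lambda _ fun n => D.measurable_kill n
  have hterm : ∀ n, ∫⁻ ω, ‖u (D.X n ω)‖ₑ * (K n).indicator 1 (c ω) ∂(D.P x)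
      = ENNReal.ofReal (1 - D.α) *
        (ENNReal.ofReal D.α ^ n * D.transition^[n] (fun y => ‖u y‖ₑ) x) := by
    intro n
    have hX : Measurable fun q : (ℕ → E) × (Fin 2 × ℕ → ℝ) => ‖u (q.1 n)‖ₑ := by fun_prop
    have hI : Measurable ((K n).indicator (1 : (ℕ → Bool) → ℝ≥0∞)) :=
      measurable_one.indicator (hKm n)
    have := lintegral_mul_eq_lintegral_mul_lintegral_of_indepFun
      (hX.comp (D.measurable_path.prodMk D.measurable_devices)) (hI.comp hcm)
      ((D.indep_X_ξ_kill x).comp hX hI)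
    simp only [Pi.mul_apply, Function.comp_apply] at this
    rw [this, D.lintegral_X x n hm.enorm]
    have e : ∫⁻ ω, (K n).indicator (1 : (ℕ → Bool) → ℝ≥0∞) (c ω) ∂(D.P x)
        = D.P x (c ⁻¹' K n) := by
      rw [← lintegral_indicator_one (hcm (hKm n))]; rfl
    rw [e, D.measure_last_alive x n]
    ring
  have hle : ENNReal.ofReal (1 - D.α) * D.potential (fun y => ‖u y‖ₑ) x
      ≤ ∫⁻ ω, ⨆ n : ℕ, ‖(D.killed n ω).elim 0 u‖ₑ ∂(D.P x) := by
    rw [potential, ← ENNReal.tsum_mul_left]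
    simp only [← hterm]
    rw [← lintegral_tsum (f := fun n ω => ‖u (D.X n ω)‖ₑ * (K n).indicator 1 (c ω))
      fun n => ((hm.comp (D.measurable_X n)).enorm.mul
      ((measurable_one.indicator (hKm n)).comp hcm)).aemeasurable]
    refine lintegral_mono fun ω => ?_
    -- The events `K n` are disjoint, so at most one term of the series is nonzero.
    by_cases h : ∃ n, c ω ∈ K n
    · obtain ⟨n, hn⟩ := h
      have huniq : ∀ m, m ≠ n → c ω ∉ K m := by
        intro m hmn hm'
        rcases lt_or_gt_of_ne hmn with h | h
        · simpa [hn.1 m h] using hm'.2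
        · simpa [hm'.1 n h] using hn.2
      rw [tsum_eq_single n fun m hmn => by simp [huniq m hmn]]
      refine le_trans ?_ (le_iSup (fun n => ‖(D.killed n ω).elim 0 u‖ₑ) n)
      rw [D.killed_eq_some hn.1]
      simp [hn]
    · push Not at h
      simp [h]
  have hα : ENNReal.ofReal (1 - D.α) ≠ 0 := by simp [D.α_lt_one]
  intro htop
  rw [htop, ENNReal.mul_top hα] at hle
  exact (hu x).ne (top_le_iff.1 hle)

theorem transition_iterate_add (D : Model E Ω) {u v : E → ℝ≥0∞} (hu : Measurable u) (n : ℕ) :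
    D.transition^[n] (u + v) = D.transition^[n] u + D.transition^[n] v := by
  induction n generalizing u v with
  | zero => rfl
  | succ n ih =>
    have : D.transition (u + v) = D.transition u + D.transition v := by
      funext x; exact lintegral_add_left hu v
    simp only [Function.iterate_succ_apply, this, ih (D.measurable_transition hu)]

theorem potential_add (D : Model E Ω) {u v : E → ℝ≥0∞} (hu : Measurable u) (x : E) :
    D.potential (u + v) x = D.potential u x + D.potential v x := by
  simp only [potential, D.transition_iterate_add hu, Pi.add_apply, mul_add]
  exact ENNReal.tsum_add

end Model

/-- The joint law is a threefold product, and products of measures can be reassociated. -/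
theorem indepFun_prodMk_left {Ω α β γ : Type*} [MeasurableSpace Ω] [MeasurableSpace α]
    [MeasurableSpace β] [MeasurableSpace γ] {μ : Measure Ω} [IsProbabilityMeasure μ]
    {X : Ω → α} {Y : Ω → β} {Z : Ω → γ} (hX : Measurable X) (hY : Measurable Y)
    (hZ : Measurable Z) (h : IndepFun X (fun ω => (Y ω, Z ω)) μ) (hYZ : IndepFun Y Z μ) :
    IndepFun (fun ω => (X ω, Y ω)) Z μ := by
  have := Measure.isProbabilityMeasure_map (μ := μ) hX.aemeasurable
  have := Measure.isProbabilityMeasure_map (μ := μ) hY.aemeasurable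
  have := Measure.isProbabilityMeasure_map (μ := μ) hZ.aemeasurable
  have hXY : IndepFun X Y μ := h.comp measurable_id measurable_fst
  rw [indepFun_iff_map_prod_eq_prod_map_map (hX.prodMk hY).aemeasurable hZ.aemeasurable,
    hXY.map_prod_eq_prod_map_map hX.aemeasurable hY.aemeasurable]
  have h1 := h.map_prod_eq_prod_map_map hX.aemeasurable (hY.prodMk hZ).aemeasurable
  rw [hYZ.map_prod_eq_prod_map_map hY.aemeasurable hZ.aemeasurable] at h1
  have h2 := congrArg (Measure.map (MeasurableEquiv.prodAssoc (α := α) (β := β) (γ := γ)).symm) h1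
  rw [Measure.map_map (by fun_prop) (by fun_prop)] at h2
  rw [((measurePreserving_prodAssoc (μ.map X) (μ.map Y) (μ.map Z)).symm _).map_eq] at h2
  exact h2

namespace Model

variable {E Ω : Type*} [MeasurableSpace E] [MeasurableSpace Ω]

/-! ### Averaging out a randomization device -/

/-- Overwriting coordinate k by 0 erases that device while keeping the type, so the left component
carries everything except device k. -/
theorem indepFun_update_device (D : Model E Ω) (x : E) (k : Fin 2 × ℕ) :
    IndepFun (fun ω => ((fun m => D.X m ω : ℕ → E),
      Function.update (fun l : Fin 2 × ℕ => D.ξ l.1 l.2 ω) k 0)) (D.ξ k.1 k.2) (D.P x) := by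
  have hU : Measurable fun z : Fin 2 × ℕ → ℝ => Function.update z k 0 :=
    measurable_update_left
  refine indepFun_prodMk_left D.measurable_path (hU.comp D.measurable_devices)
    (D.measurable_ξ _ _) ?_ ?_
  · exact (D.indep_X_ξ x).comp (ψ := fun z : Fin 2 × ℕ → ℝ => (Function.update z k 0, z k))
      measurable_id (hU.prodMk (measurable_pi_apply k))
  · have h := indep_iSup_of_disjoint
      (fun l : Fin 2 × ℕ => (D.measurable_ξ l.1 l.2).comap_le) (D.indep_ξ x)
      (S := {k}ᶜ) (T := {k}) disjoint_compl_left
    refine indep_of_indep_of_le h ?_ (le_iSup₂_of_le k rfl le_rfl)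
    refine Measurable.comap_le ?_
    refine @measurable_pi_lambda _ _ _
      (⨆ l ∈ ({k} : Set (Fin 2 × ℕ))ᶜ, MeasurableSpace.comap (D.ξ l.1 l.2) inferInstance)
      _ _ fun l => ?_
    by_cases hl : l = k
    · subst hl; simp
    · simp only [Function.update_of_ne hl]
      exact Measurable.of_comap_le (le_iSup₂_of_le (f := fun l (_ : l ∈ ({k} : Set _)ᶜ) =>
        MeasurableSpace.comap (D.ξ l.1 l.2) inferInstance) l hl le_rfl)

theorem uniform_real_Iic {c : ℝ} (hc : c ∈ Set.Icc (0 : ℝ) 1) :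
    (volume.restrict (Set.Ioo (0 : ℝ) 1)).real (Set.Iic c) = c := by
  rw [Measure.restrict_congr_set Ioo_ae_eq_Ioc, measureReal_restrict_apply measurableSet_Iic,
    Set.inter_comm, Set.Ioc_inter_Iic, min_eq_right hc.2]
  simp [hc.1]

/-- By Fubini: given everything but the device (i, n), on which v does not depend by `hv'`, the
uniform device falls below p(Xₙ) with probability p(Xₙ). -/
theorem integral_mul_device (D : Model E Ω) (x : E) (i : Fin 2) (n : ℕ) (p : Strategy E)
    {v : (ℕ → E) × (Fin 2 × ℕ → ℝ) → ℝ} (hv : Measurable v)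
    (hv' : ∀ y z t, v (y, Function.update z (i, n) t) = v (y, z))
    (hi : Integrable (fun ω => v (fun m => D.X m ω, fun l => D.ξ l.1 l.2 ω)) (D.P x)) :
    ∫ ω, v (fun m => D.X m ω, fun l => D.ξ l.1 l.2 ω) *
        {ω | D.ξ i n ω ≤ p.toFun (D.X n ω)}.indicator 1 ω ∂(D.P x)
      = ∫ ω, v (fun m => D.X m ω, fun l => D.ξ l.1 l.2 ω) * p.toFun (D.X n ω) ∂(D.P x) := by
  set Y : Ω → (ℕ → E) × (Fin 2 × ℕ → ℝ) := fun ω => ((fun m => D.X m ω : ℕ → E),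
      Function.update (fun l : Fin 2 × ℕ => D.ξ l.1 l.2 ω) (i, n) 0) with hY
  have hYm : Measurable Y :=
    D.measurable_path.prodMk (measurable_update_left.comp D.measurable_devices)
  have hvY : ∀ ω, v (fun m => D.X m ω, fun l => D.ξ l.1 l.2 ω) = v (Y ω) :=
    fun ω => (hv' _ _ _).symm
  simp only [hvY] at hi ⊢
  have hmap := (D.indepFun_update_device x (i, n)).map_prod_eq_prod_map_map hYm.aemeasurable
    (D.measurable_ξ i n).aemeasurable
  rw [D.law_ξ] at hmap
  have hpn : Measurable fun y : (ℕ → E) × (Fin 2 × ℕ → ℝ) => p.toFun (y.1 n) :=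
    p.measurable_toFun.comp (by fun_prop)
  set S : Set (((ℕ → E) × (Fin 2 × ℕ → ℝ)) × ℝ) := {q | q.2 ≤ p.toFun (q.1.1 n)} with hS
  have hSm : MeasurableSet S := measurableSet_le measurable_snd (hpn.comp measurable_fst)
  set w : ((ℕ → E) × (Fin 2 × ℕ → ℝ)) × ℝ → ℝ := fun q => v q.1 * S.indicator 1 q with hw
  have hwm : Measurable w := (hv.comp measurable_fst).mul (measurable_one.indicator hSm)
  have hYZ : Measurable fun ω => (Y ω, D.ξ i n ω) := hYm.prodMk (D.measurable_ξ i n)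
  have hwi : Integrable w ((D.P x).map fun ω => (Y ω, D.ξ i n ω)) := by
    rw [integrable_map_measure hwm.aestronglyMeasurable hYZ.aemeasurable]
    refine hi.mono (hwm.comp hYZ).aestronglyMeasurable (ae_of_all _ fun ω => ?_)
    simp only [hw, Function.comp_apply, Set.indicator]
    split_ifs <;> simp
  have e : (fun ω => v (Y ω) * {ω | D.ξ i n ω ≤ p.toFun (D.X n ω)}.indicator 1 ω)
      = fun ω => w (Y ω, D.ξ i n ω) := rfl
  have := Measure.isProbabilityMeasure_map (μ := D.P x) hYm.aemeasurable
  rw [e, ← integral_map (f := w) hYZ.aemeasurable hwm.aestronglyMeasurable]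
  erw [hmap] at hwi ⊢
  rw [integral_prod _ hwi,
    integral_map hYm.aemeasurable
      hwi.integral_prod_left.aestronglyMeasurable]
  refine integral_congr_ae (ae_of_all _ fun ω => ?_)
  simp only [hw]
  rw [integral_const_mul]
  congr 1
  exact (integral_indicator_one (s := Set.Iic (p.toFun (D.X n ω))) measurableSet_Iic).trans
    (uniform_real_Iic (p.mem_Icc _))

/-! ### Functions dominated by the potential of the payoffs -/

/-- The sum of the absolute values of the payoff functions. -/
noncomputable def payoffBound {E : Type*} (f g h : E → ℝ) (x : E) : ℝ≥0∞ :=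
  ‖f x‖ₑ + ‖g x‖ₑ + ‖h x‖ₑ

/-- Measurable payoff functions whose discounted potential is finite. -/
structure FinitePotential (D : Model E Ω) (f g h : E → ℝ) : Prop where
  measurable_f : Measurable f
  measurable_g : Measurable g
  measurable_h : Measurable h
  ne_top : ∀ x, D.potential (payoffBound f g h) x ≠ ∞

theorem Standing.finitePotential {D : Model E Ω} {f g h : E → ℝ}
    (hG : D.Standing (zeroSum f g h)) : D.FinitePotential f g h where
  measurable_f := hG.measurable_f 0
  measurable_g := hG.measurable_g 0
  measurable_h := hG.measurable_h 0
  ne_top x := by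
    have hf : Measurable f := hG.measurable_f 0
    have hg : Measurable g := hG.measurable_g 0
    have hh : Measurable h := hG.measurable_h 0
    have e : payoffBound f g h
        = ((fun y => ‖f y‖ₑ) + fun y => ‖g y‖ₑ) + fun y => ‖h y‖ₑ := rfl
    rw [e, D.potential_add (hf.enorm.add hg.enorm), D.potential_add hf.enorm]
    exact ENNReal.add_ne_top.2 ⟨ENNReal.add_ne_top.2
      ⟨(hG.integrable_f 0).potential_ne_top hf x, (hG.integrable_g 0).potential_ne_top hg x⟩,
      (hG.integrable_h 0).potential_ne_top hh x⟩

theorem payoffBound_neg_swap {E : Type*} (f g h : E → ℝ) :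
    payoffBound (-g) (-f) (-h) = payoffBound f g h := by
  funext x; simp [payoffBound, add_comm]

/-- Player 2 maximizes in the game with payoffs -g, -f, -h, so results for one player transfer to
the other. -/
theorem FinitePotential.neg_swap {D : Model E Ω} {f g h : E → ℝ}
    (hb : D.FinitePotential f g h) : D.FinitePotential (-g) (-f) (-h) where
  measurable_f := hb.measurable_g.neg
  measurable_g := hb.measurable_f.neg
  measurable_h := hb.measurable_h.neg
  ne_top x := by rw [payoffBound_neg_swap]; exact hb.ne_top x

theorem FinitePotential.measurable_payoffBound {D : Model E Ω} {f g h : E → ℝ}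
    (hb : D.FinitePotential f g h) : Measurable (payoffBound f g h) :=
  (hb.measurable_f.enorm.add hb.measurable_g.enorm).add hb.measurable_h.enorm

/-- Measurable functions dominated by a discounted potential. -/
structure Dominated (D : Model E Ω) (F : E → ℝ≥0∞) (V : E → ℝ) : Prop where
  measurable : Measurable V
  le : ∀ x, ‖V x‖ₑ ≤ D.potential F x

theorem ofReal_α_ne_zero (D : Model E Ω) : ENNReal.ofReal D.α ≠ 0 := by
  simpa using D.α_pos

theorem enorm_α_pow (D : Model E Ω) (n : ℕ) : ‖D.α ^ n‖ₑ = ENNReal.ofReal D.α ^ n := by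
  rw [enorm_pow, Real.enorm_of_nonneg D.α_pos.le]

section

variable {D : Model E Ω} {f g h V : E → ℝ}

theorem FinitePotential.lintegral_ne_top (hb : D.FinitePotential f g h) (x : E) (n : ℕ) :
    ∫⁻ ω, D.potential (payoffBound f g h) (D.X n ω) ∂(D.P x) ≠ ∞ := by
  intro htop
  have := D.lintegral_potential_X_ne_top x n hb.measurable_payoffBound (hb.ne_top x)
  rw [htop, ENNReal.mul_top (pow_ne_zero _ D.ofReal_α_ne_zero)] at this
  exact this rfl

theorem Dominated.integrable (hV : D.Dominated (payoffBound f g h) V)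
    (hb : D.FinitePotential f g h) (x : E) (n : ℕ) :
    Integrable (fun ω => V (D.X n ω)) (D.P x) :=
  ⟨(hV.measurable.comp (D.measurable_X n)).aestronglyMeasurable,
    (lintegral_mono fun ω => hV.le (D.X n ω)).trans_lt (hb.lintegral_ne_top x n).lt_top⟩

theorem Dominated.enorm_continuation_le (hV : D.Dominated (payoffBound f g h) V) (x : E) :
    ‖D.continuation V x‖ₑ
      ≤ ENNReal.ofReal D.α * D.transition (D.potential (payoffBound f g h)) x := by
  rw [continuation, enorm_mul, Real.enorm_of_nonneg D.α_pos.le]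
  gcongr
  exact (enorm_integral_le_lintegral_enorm _).trans (lintegral_mono hV.le)

theorem Dominated.measurable_continuation (hV : D.Dominated (payoffBound f g h) V) :
    Measurable (D.continuation V) :=
  hV.measurable.stronglyMeasurable.integral_kernel.measurable.const_mul _

theorem Dominated.continuation (hV : D.Dominated (payoffBound f g h) V)
    (hb : D.FinitePotential f g h) :
    D.Dominated (payoffBound f g h) (D.continuation V) where
  measurable := hV.measurable_continuation
  le x := by
    rw [D.potential_eq hb.measurable_payoffBound]
    exact (hV.enorm_continuation_le x).trans le_add_self

theorem FinitePotential.dominated_of_le (hb : D.FinitePotential f g h) (hm : Measurable V)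
    (hle : ∀ x, ‖V x‖ₑ ≤ payoffBound f g h x) : D.Dominated (payoffBound f g h) V where
  measurable := hm
  le x := by
    rw [D.potential_eq hb.measurable_payoffBound]
    exact (hle x).trans le_self_add

theorem FinitePotential.dominated_f (hb : D.FinitePotential f g h) :
    D.Dominated (payoffBound f g h) f :=
  hb.dominated_of_le hb.measurable_f fun _ => le_self_add.trans le_self_add

theorem FinitePotential.dominated_g (hb : D.FinitePotential f g h) :
    D.Dominated (payoffBound f g h) g :=
  hb.dominated_of_le hb.measurable_g fun _ => le_add_self.trans le_self_add

theorem FinitePotential.dominated_h (hb : D.FinitePotential f g h) :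
    D.Dominated (payoffBound f g h) h :=
  hb.dominated_of_le hb.measurable_h fun _ => le_add_self

theorem Dominated.neg (hV : D.Dominated (payoffBound f g h) V) :
    D.Dominated (payoffBound (-g) (-f) (-h)) (-V) where
  measurable := hV.measurable.neg
  le x := by rw [payoffBound_neg_swap, Pi.neg_apply, enorm_neg]; exact hV.le x

theorem continuation_neg (D : Model E Ω) (V : E → ℝ) :
    D.continuation (-V) = -D.continuation V := by
  funext x; simp [Model.continuation, integral_neg]

theorem Dominated.setIntegral_X_succ (hV : D.Dominated (payoffBound f g h) V)
    (hb : D.FinitePotential f g h) (x : E) (n : ℕ) {A : Set Ω}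
    (hA : MeasurableSet[D.fullFiltration n] A) :
    ∫ ω in A, D.α ^ (n + 1) * V (D.X (n + 1) ω) ∂(D.P x)
      = ∫ ω in A, D.α ^ n * D.continuation V (D.X n ω) ∂(D.P x) := by
  simp only [Model.continuation]
  rw [integral_const_mul, integral_const_mul, integral_const_mul,
    D.setIntegral_X_succ x n hA hV.measurable (hV.integrable hb x _), pow_succ, mul_assoc]

/-- The transversality condition: the terms are bounded by tails of the potential series, whatever
the sets. -/
theorem Dominated.tendsto_setIntegral (hV : D.Dominated (payoffBound f g h) V)
    (hb : D.FinitePotential f g h) (x : E) (A : ℕ → Set Ω) :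
    Tendsto (fun n => ∫ ω in A n, D.α ^ n * V (D.X n ω) ∂(D.P x)) atTop (𝓝 0) := by
  rw [tendsto_zero_iff_enorm_tendsto_zero]
  refine tendsto_of_tendsto_of_tendsto_of_le_of_le tendsto_const_nhds
    (D.tendsto_lintegral_potential_X x hb.measurable_payoffBound (hb.ne_top x))
    (fun _ => zero_le) fun n => ?_
  rw [integral_const_mul]
  simp only [enorm_mul, D.enorm_α_pow]
  gcongr
  calc _ ≤ ∫⁻ ω in A n, ‖V (D.X n ω)‖ₑ ∂(D.P x) := enorm_integral_le_lintegral_enorm _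
    _ ≤ ∫⁻ ω, ‖V (D.X n ω)‖ₑ ∂(D.P x) := setLIntegral_le_lintegral _ _
    _ ≤ _ := lintegral_mono fun ω => hV.le _

end

/-! ### Decomposition of the reward according to the end of the game -/

/-- The reward received at time `n`. -/
noncomputable def stage (D : Model E Ω) (f g h : E → ℝ) (τ σ : Ω → WithTop ℕ) (n : ℕ) (ω : Ω) :
    ℝ :=
  D.α ^ n * ({ω | τ ω = n ∧ n < σ ω}.indicator (fun ω => f (D.X n ω)) ω
    + {ω | n < τ ω ∧ σ ω = n}.indicator (fun ω => g (D.X n ω)) ω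
    + {ω | τ ω = n ∧ σ ω = n}.indicator (fun ω => h (D.X n ω)) ω)

/-- At most one stage is nonzero, the one at the minimum of τ and σ. -/
theorem hasSum_stage (D : Model E Ω) (f g h : E → ℝ) (τ σ : Ω → WithTop ℕ) (ω : Ω) :
    HasSum (fun n => D.stage f g h τ σ n ω) (D.reward f g h τ σ ω) := by
  have key : ∀ m : ℕ, (∀ n : ℕ, n ≠ m → D.stage f g h τ σ n ω = 0) →
      D.stage f g h τ σ m ω = D.reward f g h τ σ ω →
      HasSum (fun n => D.stage f g h τ σ n ω) (D.reward f g h τ σ ω) :=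
    fun m h1 h2 => h2 ▸ hasSum_single m h1
  have hu : ∀ n : ℕ, WithTop.untopD 0 (n : WithTop ℕ) = n := fun _ => rfl
  cases hτ : τ ω with
  | top =>
    cases hσ : σ ω with
    | top =>
      have h0 : ∀ n, D.stage f g h τ σ n ω = 0 := by
        intro n; simp [stage, hτ, hσ]
      simp [h0, reward, hτ, hσ, hasSum_zero]
    | coe s =>
      refine key s (fun n hn => ?_) ?_
      · simp [stage, hτ, hσ, hn.symm]
      · simp [stage, reward, hτ, hσ, hu]
  | coe t =>
    cases hσ : σ ω with
    | top =>
      refine key t (fun n hn => ?_) ?_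
      · simp [stage, hτ, hσ, hn.symm]
      · simp [stage, reward, hτ, hσ, hu]
    | coe s =>
      rcases lt_trichotomy t s with hts | hts | hts
      · refine key t (fun n hn => ?_) ?_
        · have h1 : ¬ (n < t ∧ s = n) := by omega
          simp [stage, hτ, hσ, Set.indicator, hn.symm]
          omega
        · simp [stage, reward, hτ, hσ, hu, Set.indicator, hts, hts.ne']
      · subst hts
        refine key t (fun n hn => ?_) ?_
        · simp [stage, hτ, hσ, Set.indicator, hn.symm]
        · simp [stage, reward, hτ, hσ, hu, Set.indicator]
      · refine key s (fun n hn => ?_) ?_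
        · simp [stage, hτ, hσ, Set.indicator, hn.symm]
          omega
        · simp [stage, reward, hτ, hσ, hu, Set.indicator, hts, hts.ne', hts.not_gt]

theorem natCast_succ_le_iff (n : ℕ) (a : WithTop ℕ) :
    ((n + 1 : ℕ) : WithTop ℕ) ≤ a ↔ (n : WithTop ℕ) < a := by
  cases a with
  | top => simp
  | coe a => rw [← WithTop.coe_natCast, ← WithTop.coe_natCast]; norm_cast

/-- Surviving beyond n is already decided at time n, not merely at n + 1, so the Markov step from n
to n + 1 may be taken on this event. -/
theorem measurableSet_lt_stopping (D : Model E Ω) {τ σ : Ω → WithTop ℕ}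
    (hτ : IsStoppingTime D.fullFiltration τ) (hσ : IsStoppingTime D.fullFiltration σ) (n : ℕ) :
    MeasurableSet[D.fullFiltration n]
      {ω | ((n + 1 : ℕ) : WithTop ℕ) ≤ τ ω ∧ ((n + 1 : ℕ) : WithTop ℕ) ≤ σ ω} := by
  have e : {ω | ((n + 1 : ℕ) : WithTop ℕ) ≤ τ ω ∧ ((n + 1 : ℕ) : WithTop ℕ) ≤ σ ω}
      = {ω | (n : WithTop ℕ) < τ ω} ∩ {ω | (n : WithTop ℕ) < σ ω} := by
    ext ω
    simp only [Set.mem_inter_iff, Set.mem_ofPred_eq, natCast_succ_le_iff]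
  rw [e]
  exact (hτ.measurableSet_gt n).inter (hσ.measurableSet_gt n)

section

variable {D : Model E Ω} {f g h : E → ℝ} {τ σ : Ω → WithTop ℕ}

theorem FinitePotential.measurable_stage (hb : D.FinitePotential f g h)
    (hτ : IsStoppingTime D.fullFiltration τ) (hσ : IsStoppingTime D.fullFiltration σ) (n : ℕ) :
    Measurable (D.stage f g h τ σ n) := by
  have le := D.fullFiltration.le n
  have t1 := le _ (hτ.measurableSet_eq n)
  have t2 := le _ (hτ.measurableSet_gt n)
  have s1 := le _ (hσ.measurableSet_eq n)
  have s2 := le _ (hσ.measurableSet_gt n)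
  exact ((((hb.measurable_f.comp (D.measurable_X n)).indicator (t1.inter s2)).add
    ((hb.measurable_g.comp (D.measurable_X n)).indicator (t2.inter s1))).add
    ((hb.measurable_h.comp (D.measurable_X n)).indicator (t1.inter s1))).const_mul _

theorem enorm_stage_le (n : ℕ) (ω : Ω) :
    ‖D.stage f g h τ σ n ω‖ₑ
      ≤ ENNReal.ofReal D.α ^ n * payoffBound f g h (D.X n ω) := by
  rw [stage, enorm_mul, D.enorm_α_pow, payoffBound]
  gcongr
  refine (enorm_add_le _ _).trans (add_le_add ((enorm_add_le _ _).trans (add_le_add ?_ ?_)) ?_)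
  all_goals exact enorm_indicator_le_enorm_self _ _

theorem FinitePotential.tsum_lintegral_stage_ne_top (hb : D.FinitePotential f g h) (x : E) :
    ∑' n, ∫⁻ ω, ‖D.stage f g h τ σ n ω‖ₑ ∂(D.P x) ≠ ∞ := by
  refine ne_top_of_le_ne_top (hb.ne_top x) (ENNReal.tsum_le_tsum fun n => ?_)
  rw [← D.lintegral_X x n hb.measurable_payoffBound,
    ← lintegral_const_mul (f := fun ω => payoffBound f g h (D.X n ω)) _
      (hb.measurable_payoffBound.comp (D.measurable_X n))]
  exact lintegral_mono fun ω => enorm_stage_le n ω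

theorem FinitePotential.integrable_stage (hb : D.FinitePotential f g h)
    (hτ : IsStoppingTime D.fullFiltration τ) (hσ : IsStoppingTime D.fullFiltration σ) (x : E)
    (n : ℕ) : Integrable (D.stage f g h τ σ n) (D.P x) :=
  ⟨(hb.measurable_stage hτ hσ n).aestronglyMeasurable,
    (ENNReal.ne_top_of_tsum_ne_top (hb.tsum_lintegral_stage_ne_top x) n).lt_top⟩

theorem FinitePotential.hasSum_integral_stage (hb : D.FinitePotential f g h)
    (hτ : IsStoppingTime D.fullFiltration τ) (hσ : IsStoppingTime D.fullFiltration σ) (x : E) :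
    HasSum (fun n => ∫ ω, D.stage f g h τ σ n ω ∂(D.P x))
      (∫ ω, D.reward f g h τ σ ω ∂(D.P x)) := by
  have := hasSum_integral_of_summable_integral_norm (hb.integrable_stage hτ hσ x) (by
    simp only [integral_norm_eq_lintegral_enorm
      (hb.measurable_stage hτ hσ _).aestronglyMeasurable]
    exact ENNReal.summable_toReal (hb.tsum_lintegral_stage_ne_top x))
  simpa only [(D.hasSum_stage f g h τ σ _).tsum_eq] using this

theorem FinitePotential.enorm_integral_reward_le (hb : D.FinitePotential f g h) (x : E) :
    ‖∫ ω, D.reward f g h τ σ ω ∂(D.P x)‖ₑ ≤ D.potential (payoffBound f g h) x := by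
  refine (enorm_integral_le_lintegral_enorm _).trans ?_
  calc ∫⁻ ω, ‖D.reward f g h τ σ ω‖ₑ ∂(D.P x)
      ≤ ∫⁻ ω, ∑' n, ENNReal.ofReal D.α ^ n * payoffBound f g h (D.X n ω) ∂(D.P x) := by
        refine lintegral_mono fun ω => ?_
        rw [← (D.hasSum_stage f g h τ σ ω).tsum_eq]
        exact (enorm_tsum_le_tsum_enorm).trans (ENNReal.tsum_le_tsum fun n => enorm_stage_le n ω)
    _ = D.potential (payoffBound f g h) x := by
        rw [lintegral_tsum
          (f := fun n ω => ENNReal.ofReal D.α ^ n * payoffBound f g h (D.X n ω)) fun n =>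
          ((hb.measurable_payoffBound.comp (D.measurable_X n)).const_mul _).aemeasurable]
        refine tsum_congr fun n => ?_
        rw [lintegral_const_mul (f := fun ω => payoffBound f g h (D.X n ω)) _
          (hb.measurable_payoffBound.comp (D.measurable_X n)),
          D.lintegral_X x n hb.measurable_payoffBound]

end

end Model

/-! ### One-shot matrix games -/

/-- The expected payoff of the `2 × 2` matrix game with rows `(h, f)` and `(g, c)` if the players
choose the first row and the first column with probabilities `s` and `t`. -/
def matrixGame (f g h c s t : ℝ) : ℝ :=
  s * (1 - t) * f + (1 - s) * t * g + s * t * h + (1 - s) * (1 - t) * c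

/-- The payoff is affine in each action, so a random action can be replaced by its conditional mean.
-/
theorem matrixGame_eq_left (f g h c s t : ℝ) :
    matrixGame f g h c s t
      = matrixGame f g h c 0 t + (matrixGame f g h c 1 t - matrixGame f g h c 0 t) * s := by
  simp only [matrixGame]; ring

theorem matrixGame_eq_right (f g h c s t : ℝ) :
    matrixGame f g h c s t
      = matrixGame f g h c s 0 + (matrixGame f g h c s 1 - matrixGame f g h c s 0) * t := by
  simp only [matrixGame]; ring

namespace Model

variable {E Ω : Type*} [MeasurableSpace E] [MeasurableSpace Ω]

/-! ### Stopping times given by time-dependent Markovian strategies -/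

open Classical in
/-- The randomized stopping time `inf {n : Pₙ (Xₙ) ≥ ξⁱₙ}` of player `i`. -/
noncomputable def seqTime (D : Model E Ω) (i : Fin 2) (P : ℕ → Strategy E) (ω : Ω) : WithTop ℕ :=
  if H : ∃ n : ℕ, D.ξ i n ω ≤ (P n).toFun (D.X n ω) then ((Nat.find H : ℕ) : WithTop ℕ) else ⊤

theorem le_seqTime_iff (D : Model E Ω) (i : Fin 2) (P : ℕ → Strategy E) (n : ℕ) (ω : Ω) :
    (n : WithTop ℕ) ≤ D.seqTime i P ω ↔ ∀ k < n, (P k).toFun (D.X k ω) < D.ξ i k ω := by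
  unfold seqTime
  split_ifs with H
  · rw [Nat.cast_le, Nat.le_find_iff]
    simp only [not_le]
  · push Not at H
    simp [H]

theorem seqTime_eq_iff (D : Model E Ω) (i : Fin 2) (P : ℕ → Strategy E) {n : ℕ} {ω : Ω}
    (h : (n : WithTop ℕ) ≤ D.seqTime i P ω) :
    D.seqTime i P ω = n ↔ D.ξ i n ω ≤ (P n).toFun (D.X n ω) := by
  rw [← not_iff_not, not_le]
  have : ¬ D.seqTime i P ω = n ↔ ((n + 1 : ℕ) : WithTop ℕ) ≤ D.seqTime i P ω := by
    rw [natCast_succ_le_iff]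
    exact ⟨fun h' => lt_of_le_of_ne h (Ne.symm h'), fun h' => h'.ne'⟩
  rw [this, le_seqTime_iff]
  rw [le_seqTime_iff] at h
  exact ⟨fun h' => h' n n.lt_succ_self, fun h' k hk =>
    (Nat.lt_succ_iff_lt_or_eq.1 hk).elim (h k) fun e => e ▸ h'⟩

theorem seqTime_mem_admissible (D : Model E Ω) (i : Fin 2) (P : ℕ → Strategy E) :
    D.seqTime i P ∈ D.admissible i := by
  intro n
  have e : {ω | D.seqTime i P ω ≤ n}
      = (⋂ k, ⋂ (_ : k < n + 1), {ω | (P k).toFun (D.X k ω) < D.ξ i k ω})ᶜ := by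
    ext ω
    rw [Set.mem_ofPred_eq, ← not_lt, ← natCast_succ_le_iff, le_seqTime_iff]
    simp
  change MeasurableSet[D.filtration i n] {ω | D.seqTime i P ω ≤ (Nat.cast n : WithTop ℕ)}
  rw [e]
  refine MeasurableSet.compl (MeasurableSet.iInter fun k => MeasurableSet.iInter fun hk => ?_)
  have hk' : k ≤ n := Nat.lt_succ_iff.1 hk
  have hX : Measurable[D.filtration i n] (D.X k) :=
    (D.measurable_X_pathHistory hk').mono le_sup_left le_rfl
  have hξ : Measurable[D.filtration i n] (D.ξ i k) :=
    Measurable.of_comap_le ((le_iSup₂_of_le (f := fun k (_ : k ≤ n) =>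
      MeasurableSpace.comap (D.ξ i k) inferInstance) k hk' le_rfl).trans le_sup_right)
  exact measurableSet_lt ((P k).measurable_toFun.comp hX) hξ

theorem isStoppingTime_of_admissible (D : Model E Ω) {i : Fin 2} {τ : Ω → WithTop ℕ}
    (h : τ ∈ D.admissible i) : IsStoppingTime D.fullFiltration τ :=
  fun n => D.filtration_le_fullFiltration i n _ (h n)

theorem isStoppingTime_seqTime (D : Model E Ω) (i : Fin 2) (P : ℕ → Strategy E) :
    IsStoppingTime D.fullFiltration (D.seqTime i P) :=
  D.isStoppingTime_of_admissible (D.seqTime_mem_admissible i P)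

theorem integral_add_mul_device (D : Model E Ω) (x : E) (i : Fin 2) (n : ℕ) (p : Strategy E)
    {u : Ω → ℝ} {v : (ℕ → E) × (Fin 2 × ℕ → ℝ) → ℝ} (hu : Integrable u (D.P x)) (hv : Measurable v)
    (hv' : ∀ y z t, v (y, Function.update z (i, n) t) = v (y, z))
    (hi : Integrable (fun ω => v (fun m => D.X m ω, fun l => D.ξ l.1 l.2 ω)) (D.P x)) :
    ∫ ω, u ω + v (fun m => D.X m ω, fun l => D.ξ l.1 l.2 ω) *
        {ω | D.ξ i n ω ≤ p.toFun (D.X n ω)}.indicator 1 ω ∂(D.P x)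
      = ∫ ω, u ω + v (fun m => D.X m ω, fun l => D.ξ l.1 l.2 ω) * p.toFun (D.X n ω) ∂(D.P x) := by
  have hpm : Measurable fun ω => p.toFun (D.X n ω) := p.measurable_toFun.comp (D.measurable_X n)
  have hS : MeasurableSet {ω | D.ξ i n ω ≤ p.toFun (D.X n ω)} :=
    measurableSet_le (D.measurable_ξ i n) hpm
  rw [integral_add hu, integral_add hu, D.integral_mul_device x i n p hv hv' hi]
  · refine hi.mul_bdd (c := 1) hpm.aestronglyMeasurable (ae_of_all _ fun ω => ?_)
    rw [Real.norm_of_nonneg (p.mem_Icc _).1]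
    exact (p.mem_Icc _).2
  · refine hi.mul_bdd (c := 1) (measurable_one.indicator hS).aestronglyMeasurable
      (ae_of_all _ fun ω => ?_)
    simp only [Set.indicator]
    split_ifs <;> simp

/-- The event, on path space, that neither player has stopped before time `n`. -/
def aliveSet (i j : Fin 2) (P Q : ℕ → Strategy E) (n : ℕ) : Set ((ℕ → E) × (Fin 2 × ℕ → ℝ)) :=
  {q | ∀ k < n, (P k).toFun (q.1 k) < q.2 (i, k) ∧ (Q k).toFun (q.1 k) < q.2 (j, k)}

theorem measurableSet_aliveSet (i j : Fin 2) (P Q : ℕ → Strategy E) (n : ℕ) :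
    MeasurableSet (aliveSet i j P Q n) := by
  have e : aliveSet i j P Q n = ⋂ k, ⋂ (_ : k < n),
      {q | (P k).toFun (q.1 k) < q.2 (i, k)} ∩ {q | (Q k).toFun (q.1 k) < q.2 (j, k)} := by
    ext q; simp [aliveSet]
  have h : ∀ (R : Strategy E) (k : ℕ) (l : Fin 2 × ℕ),
      MeasurableSet {q : (ℕ → E) × (Fin 2 × ℕ → ℝ) | R.toFun (q.1 k) < q.2 l} := fun R k l =>
    measurableSet_lt (R.measurable_toFun.comp (by fun_prop)) (by fun_prop)
  rw [e]
  exact MeasurableSet.iInter fun k => MeasurableSet.iInter fun _ => (h _ _ _).inter (h _ _ _)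

theorem update_mem_aliveSet_iff (i j : Fin 2) (P Q : ℕ → Strategy E) (n : ℕ) (l : Fin 2)
    (y : ℕ → E) (z : Fin 2 × ℕ → ℝ) (t : ℝ) :
    (y, Function.update z (l, n) t) ∈ aliveSet i j P Q n ↔ (y, z) ∈ aliveSet i j P Q n := by
  refine forall₂_congr fun k hk => ?_
  have h : ∀ m : Fin 2, (m, k) ≠ (l, n) := fun m e => hk.ne (Prod.ext_iff.1 e).2
  simp only [Function.update_of_ne (h _)]

theorem mem_aliveSet_iff (D : Model E Ω) (i j : Fin 2) (P Q : ℕ → Strategy E) (n : ℕ) (ω : Ω) :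
    ((fun m => D.X m ω, fun l => D.ξ l.1 l.2 ω) : (ℕ → E) × (Fin 2 × ℕ → ℝ))
        ∈ aliveSet i j P Q n ↔
      (n : WithTop ℕ) ≤ D.seqTime i P ω ∧ (n : WithTop ℕ) ≤ D.seqTime j Q ω := by
  rw [le_seqTime_iff, le_seqTime_iff, ← forall₂_and]
  rfl

theorem integrable_of_coeff {μ : Measure Ω} {w u : Ω → ℝ} (hu : Integrable u μ)
    (hw : Measurable w) (h0 : ∀ ω, 0 ≤ w ω) (h1 : ∀ ω, w ω ≤ 1) :
    Integrable (fun ω => w ω * u ω) μ :=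
  hu.bdd_mul (c := 1) hw.aestronglyMeasurable
    (ae_of_all _ fun ω => by rw [Real.norm_of_nonneg (h0 ω)]; exact h1 ω)

theorem integrable_matrixGame {μ : Measure Ω} {uf ug uh uc s t : Ω → ℝ} (hf : Integrable uf μ)
    (hg : Integrable ug μ) (hh : Integrable uh μ) (hc : Integrable uc μ)
    (hs : Measurable s) (hs' : ∀ ω, s ω ∈ Set.Icc (0 : ℝ) 1)
    (ht : Measurable t) (ht' : ∀ ω, t ω ∈ Set.Icc (0 : ℝ) 1) :
    Integrable (fun ω => matrixGame (uf ω) (ug ω) (uh ω) (uc ω) (s ω) (t ω)) μ := by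
  have hs1 : ∀ ω, 0 ≤ 1 - s ω := fun ω => by linarith [(hs' ω).2]
  have ht1 : ∀ ω, 0 ≤ 1 - t ω := fun ω => by linarith [(ht' ω).2]
  have hs2 : ∀ ω, 1 - s ω ≤ 1 := fun ω => by linarith [(hs' ω).1]
  have ht2 : ∀ ω, 1 - t ω ≤ 1 := fun ω => by linarith [(ht' ω).1]
  refine Integrable.add (Integrable.add (Integrable.add ?_ ?_) ?_) ?_
  · exact integrable_of_coeff hf (hs.mul (measurable_const.sub ht))
      (fun ω => mul_nonneg (hs' ω).1 (ht1 ω)) fun ω => mul_le_one₀ (hs' ω).2 (ht1 ω) (ht2 ω)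
  · exact integrable_of_coeff hg ((measurable_const.sub hs).mul ht)
      (fun ω => mul_nonneg (hs1 ω) (ht' ω).1) fun ω => mul_le_one₀ (hs2 ω) (ht' ω).1 (ht' ω).2
  · exact integrable_of_coeff hh (hs.mul ht)
      (fun ω => mul_nonneg (hs' ω).1 (ht' ω).1) fun ω => mul_le_one₀ (hs' ω).2 (ht' ω).1 (ht' ω).2
  · exact integrable_of_coeff hc ((measurable_const.sub hs).mul (measurable_const.sub ht))
      (fun ω => mul_nonneg (hs1 ω) (ht1 ω)) fun ω => mul_le_one₀ (hs2 ω) (ht1 ω) (ht2 ω)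

section

variable {D : Model E Ω} {f g h V : E → ℝ}

/-- On the event that the game has not ended before time `n`, the reward at time `n` together with
a terminal payoff `c` if the game goes on is, in expectation, the payoff of a matrix game. -/
theorem FinitePotential.setIntegral_matrixGame (hb : D.FinitePotential f g h) {c : E → ℝ}
    (hc : D.Dominated (payoffBound f g h) c) (x : E) {i j : Fin 2} (hij : i ≠ j)
    (P Q : ℕ → Strategy E) (n : ℕ) :
    ∫ ω in {ω | (n : WithTop ℕ) ≤ D.seqTime i P ω ∧ (n : WithTop ℕ) ≤ D.seqTime j Q ω},
        D.α ^ n * matrixGame (f (D.X n ω)) (g (D.X n ω)) (h (D.X n ω)) (c (D.X n ω))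
          ((P n).toFun (D.X n ω)) ((Q n).toFun (D.X n ω)) ∂(D.P x)
      = ∫ ω, D.stage f g h (D.seqTime i P) (D.seqTime j Q) n ω ∂(D.P x)
        + ∫ ω in {ω | ((n + 1 : ℕ) : WithTop ℕ) ≤ D.seqTime i P ω ∧
            ((n + 1 : ℕ) : WithTop ℕ) ≤ D.seqTime j Q ω}, D.α ^ n * c (D.X n ω) ∂(D.P x) := by
  set τ := D.seqTime i P with hτ
  set σ := D.seqTime j Q with hσ
  have hτs := D.isStoppingTime_seqTime i P
  have hσs := D.isStoppingTime_seqTime j Q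
  set A : ℕ → Set Ω := fun n => {ω | (n : WithTop ℕ) ≤ τ ω ∧ (n : WithTop ℕ) ≤ σ ω} with hA
  set a : Ω → ℝ := {ω | D.ξ i n ω ≤ (P n).toFun (D.X n ω)}.indicator 1 with ha
  set b : Ω → ℝ := {ω | D.ξ j n ω ≤ (Q n).toFun (D.X n ω)}.indicator 1 with hbb
  set p : Ω → ℝ := fun ω => (P n).toFun (D.X n ω) with hp
  set q : Ω → ℝ := fun ω => (Q n).toFun (D.X n ω) with hq
  have hAm : ∀ n, MeasurableSet (A n) := fun n =>
    (D.fullFiltration.le n _ (hτs.measurableSet_ge n)).inter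
      (D.fullFiltration.le n _ (hσs.measurableSet_ge n))
  set M : ℝ → ℝ → Ω → ℝ := fun s t ω =>
    matrixGame (f (D.X n ω)) (g (D.X n ω)) (h (D.X n ω)) (c (D.X n ω)) s t with hM
  set w : Ω → ℝ := (A n).indicator fun _ => D.α ^ n with hw
  -- the pathwise decomposition
  have hpath : ∀ ω, w ω * M (a ω) (b ω) ω = D.stage f g h τ σ n ω
      + (A (n + 1)).indicator (fun ω => D.α ^ n * c (D.X n ω)) ω := by
    intro ω
    by_cases hω : ω ∈ A n
    · have e1 := D.seqTime_eq_iff i P hω.1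
      have e2 := D.seqTime_eq_iff j Q hω.2
      have e3 : (n : WithTop ℕ) < τ ω ↔ ¬ τ ω = n :=
        ⟨fun h' => h'.ne', fun h' => lt_of_le_of_ne hω.1 (Ne.symm h')⟩
      have e4 : (n : WithTop ℕ) < σ ω ↔ ¬ σ ω = n :=
        ⟨fun h' => h'.ne', fun h' => lt_of_le_of_ne hω.2 (Ne.symm h')⟩
      have e5 : ω ∈ A (n + 1) ↔ ¬ τ ω = n ∧ ¬ σ ω = n := by
        simp only [hA, Set.mem_ofPred_eq, natCast_succ_le_iff, e3, e4]
      simp only [hw, hM, ha, hbb, stage, Set.indicator, hω, if_true, Set.mem_ofPred_eq, e3, e4, e5,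
        ← e1, ← e2]
      -- The realized actions a, b are 0 or 1, so the matrix payoff is one of its four entries.
      by_cases c1 : τ ω = n <;> by_cases c2 : σ ω = n <;> simp [hτ, hσ] at c1 c2 <;>
        simp [c1, c2, matrixGame, hτ, hσ]
    · have h1 : ¬ (τ ω = n ∧ n < σ ω) := fun h' => hω ⟨h'.1.ge, h'.2.le⟩
      have h2 : ¬ (n < τ ω ∧ σ ω = n) := fun h' => hω ⟨h'.1.le, h'.2.ge⟩
      have h3 : ¬ (τ ω = n ∧ σ ω = n) := fun h' => hω ⟨h'.1.ge, h'.2.ge⟩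
      have h4 : ω ∉ A (n + 1) := fun h' =>
        hω ⟨((natCast_succ_le_iff _ _).1 h'.1).le, ((natCast_succ_le_iff _ _).1 h'.2).le⟩
      simp [hw, stage, Set.indicator, hω, h1, h2, h3, h4]
  have hfi := hb.dominated_f.integrable hb x n
  have hgi := hb.dominated_g.integrable hb x n
  have hhi := hb.dominated_h.integrable hb x n
  have hci := hc.integrable hb x n
  have hpm : Measurable p := (P n).measurable_toFun.comp (D.measurable_X n)
  have hqm : Measurable q := (Q n).measurable_toFun.comp (D.measurable_X n)
  have ham : Measurable a := measurable_one.indicator (measurableSet_le (D.measurable_ξ i n) hpm)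
  have hbm : Measurable b := measurable_one.indicator (measurableSet_le (D.measurable_ξ j n) hqm)
  have hind : ∀ (s : Set Ω) (ω : Ω), s.indicator (1 : Ω → ℝ) ω ∈ Set.Icc (0 : ℝ) 1 := by
    intro s ω
    simp only [Set.indicator]
    split_ifs <;> simp
  have hMi : ∀ {s t : Ω → ℝ}, Measurable s → (∀ ω, s ω ∈ Set.Icc (0 : ℝ) 1) → Measurable t →
      (∀ ω, t ω ∈ Set.Icc (0 : ℝ) 1) → Integrable (fun ω => w ω * M (s ω) (t ω) ω) (D.P x) := by
    intro s t hs hs' ht ht'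
    refine integrable_of_coeff (integrable_matrixGame hfi hgi hhi hci hs hs' ht ht')
      (measurable_const.indicator (hAm n)) (fun ω => ?_) fun ω => ?_
    · exact Set.indicator_nonneg (fun _ _ => pow_nonneg D.α_pos.le n) ω
    · simp only [hw, Set.indicator]
      split_ifs
      · exact pow_le_one₀ D.α_pos.le D.α_lt_one.le
      · exact zero_le_one
  have h0 : ∀ _ : Ω, (0 : ℝ) ∈ Set.Icc (0 : ℝ) 1 := fun _ => by simp
  have h1 : ∀ _ : Ω, (1 : ℝ) ∈ Set.Icc (0 : ℝ) 1 := fun _ => by simp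
  have hev : ∀ φ : E → ℝ, Measurable φ →
      Measurable fun r : (ℕ → E) × (Fin 2 × ℕ → ℝ) => φ (r.1 n) := fun φ hφ =>
    hφ.comp (by fun_prop)
  -- Lifts of w, and below of b, to path space, where independence of a given device can be
  -- expressed. Survival up to n uses only devices before n, and b uses only the device of player j
  -- ≠ i.
  set wh : (ℕ → E) × (Fin 2 × ℕ → ℝ) → ℝ := (aliveSet i j P Q n).indicator fun _ => D.α ^ n
    with hwh
  have hwhm : Measurable wh := measurable_const.indicator (measurableSet_aliveSet i j P Q n)
  have hwhe : ∀ ω, wh (fun m => D.X m ω, fun l => D.ξ l.1 l.2 ω) = w ω := by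
    intro ω
    have h' := D.mem_aliveSet_iff i j P Q n ω
    by_cases hω : ω ∈ A n
    · rw [hwh, hw, Set.indicator_of_mem hω, Set.indicator_of_mem (h'.2 hω)]
    · rw [hwh, hw, Set.indicator_of_notMem hω, Set.indicator_of_notMem (mt h'.1 hω)]
  have hwhu : ∀ l y z t, wh (y, Function.update z (l, n) t) = wh (y, z) := by
    intro l y z t
    have h' := update_mem_aliveSet_iff i j P Q n l y z t
    by_cases hy : (y, z) ∈ aliveSet i j P Q n
    · rw [hwh, Set.indicator_of_mem hy, Set.indicator_of_mem (h'.2 hy)]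
    · rw [hwh, Set.indicator_of_notMem hy, Set.indicator_of_notMem (mt h'.1 hy)]
  set bh : (ℕ → E) × (Fin 2 × ℕ → ℝ) → ℝ := {r | r.2 (j, n) ≤ (Q n).toFun (r.1 n)}.indicator 1
    with hbh
  have hbhm : Measurable bh := measurable_one.indicator
    (measurableSet_le (by fun_prop) (hev _ (Q n).measurable_toFun))
  have hbhu : ∀ y z t, bh (y, Function.update z (i, n) t) = bh (y, z) := by
    intro y z t
    have : (j, n) ≠ (i, n) := fun e => hij (Prod.ext_iff.1 e).1.symm
    simp [hbh, Set.indicator, Function.update_of_ne this]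
  have hmat : ∀ {s t : (ℕ → E) × (Fin 2 × ℕ → ℝ) → ℝ}, Measurable s → Measurable t →
      Measurable fun r : (ℕ → E) × (Fin 2 × ℕ → ℝ) =>
        matrixGame (f (r.1 n)) (g (r.1 n)) (h (r.1 n)) (c (r.1 n)) (s r) (t r) := by
    intro s t hs ht
    have h1 := measurable_const (a := (1 : ℝ)) |>.sub hs
    have h2 := measurable_const (a := (1 : ℝ)) |>.sub ht
    exact ((((hs.mul h2).mul (hev f hb.measurable_f)).add
      ((h1.mul ht).mul (hev g hb.measurable_g))).add
      ((hs.mul ht).mul (hev h hb.measurable_h))).add ((h1.mul h2).mul (hev c hc.measurable))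
  -- average over the device of player `i`
  have avg_left : ∫ ω, w ω * M (a ω) (b ω) ω ∂(D.P x) = ∫ ω, w ω * M (p ω) (b ω) ω ∂(D.P x) := by
    have := D.integral_add_mul_device x i n (P n)
      (u := fun ω => w ω * M 0 (b ω) ω)
      (v := fun r => wh r *
        (matrixGame (f (r.1 n)) (g (r.1 n)) (h (r.1 n)) (c (r.1 n)) 1 (bh r)
          - matrixGame (f (r.1 n)) (g (r.1 n)) (h (r.1 n)) (c (r.1 n)) 0 (bh r)))
      (hMi measurable_const h0 hbm (hind _))
      (hwhm.mul ((hmat measurable_const hbhm).sub (hmat measurable_const hbhm)))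
      (fun y z t => by simp only [hwhu, hbhu])
      (by
        simp only [hwhe, mul_sub]
        exact (hMi measurable_const h1 hbm (hind _)).sub (hMi measurable_const h0 hbm (hind _)))
    simp only [hwhe] at this
    refine (integral_congr_ae (ae_of_all _ fun ω => ?_)).trans
      (this.trans (integral_congr_ae (ae_of_all _ fun ω => ?_)))
    · simp only [hM]
      rw [matrixGame_eq_left, mul_add, ← mul_assoc]
      rfl
    · simp only [hM]
      rw [matrixGame_eq_left _ _ _ _ (p ω), mul_add, ← mul_assoc]
      rfl
  -- average over the device of player `j`
  have avg_right : ∫ ω, w ω * M (p ω) (b ω) ω ∂(D.P x) = ∫ ω, w ω * M (p ω) (q ω) ω ∂(D.P x) := by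
    have := D.integral_add_mul_device x j n (Q n)
      (u := fun ω => w ω * M (p ω) 0 ω)
      (v := fun r => wh r *
        (matrixGame (f (r.1 n)) (g (r.1 n)) (h (r.1 n)) (c (r.1 n)) ((P n).toFun (r.1 n)) 1
          - matrixGame (f (r.1 n)) (g (r.1 n)) (h (r.1 n)) (c (r.1 n)) ((P n).toFun (r.1 n)) 0))
      (hMi hpm (fun ω => (P n).mem_Icc _) measurable_const h0)
      (hwhm.mul ((hmat (hev _ (P n).measurable_toFun) measurable_const).sub
        (hmat (hev _ (P n).measurable_toFun) measurable_const)))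
      (fun y z t => by simp only [hwhu])
      (by
        simp only [hwhe, mul_sub]
        exact (hMi hpm (fun ω => (P n).mem_Icc _) measurable_const h1).sub
          (hMi hpm (fun ω => (P n).mem_Icc _) measurable_const h0))
    simp only [hwhe] at this
    refine (integral_congr_ae (ae_of_all _ fun ω => ?_)).trans
      (this.trans (integral_congr_ae (ae_of_all _ fun ω => ?_)))
    · simp only [hM]
      rw [matrixGame_eq_right, mul_add, ← mul_assoc]
    · simp only [hM]
      rw [matrixGame_eq_right _ _ _ _ _ (q ω), mul_add, ← mul_assoc]
  have hstage := hb.integrable_stage hτs hσs x n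
  have hterm : Integrable ((A (n + 1)).indicator (fun ω => D.α ^ n * c (D.X n ω))) (D.P x) :=
    (hci.const_mul _).indicator (hAm (n + 1))
  have hfinal : ∫ ω, w ω * M (p ω) (q ω) ω ∂(D.P x)
      = ∫ ω in A n, D.α ^ n * M (p ω) (q ω) ω ∂(D.P x) := by
    rw [← integral_indicator (hAm n)]
    refine integral_congr_ae (ae_of_all _ fun ω => ?_)
    simp only [hw, Set.indicator]
    split_ifs <;> simp
  rw [← integral_indicator (hAm (n + 1)), ← integral_add hstage hterm]
  exact hfinal.symm.trans (avg_right.symm.trans (avg_left.symm.trans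
    (integral_congr_ae (ae_of_all _ hpath))))

end

end Model

theorem enorm_matrixGame_le {f g h c s t : ℝ} (hs : s ∈ Set.Icc (0 : ℝ) 1)
    (ht : t ∈ Set.Icc (0 : ℝ) 1) :
    ‖matrixGame f g h c s t‖ₑ ≤ ‖f‖ₑ + ‖g‖ₑ + ‖h‖ₑ + ‖c‖ₑ := by
  have key : ∀ {u v w : ℝ}, u ∈ Set.Icc (0 : ℝ) 1 → v ∈ Set.Icc (0 : ℝ) 1 →
      ‖u * v * w‖ₑ ≤ ‖w‖ₑ := by
    intro u v w hu hv
    rw [enorm_le_iff_norm_le, norm_mul, Real.norm_of_nonneg (mul_nonneg hu.1 hv.1)]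
    exact mul_le_of_le_one_left (norm_nonneg w) (mul_le_one₀ hu.2 hv.1 hv.2)
  have hs' : 1 - s ∈ Set.Icc (0 : ℝ) 1 := ⟨by linarith [hs.2], by linarith [hs.1]⟩
  have ht' : 1 - t ∈ Set.Icc (0 : ℝ) 1 := ⟨by linarith [ht.2], by linarith [ht.1]⟩
  exact (enorm_add_le _ _).trans (add_le_add ((enorm_add_le _ _).trans (add_le_add
    ((enorm_add_le _ _).trans (add_le_add (key hs ht') (key hs' ht))) (key hs ht))) (key hs' ht'))

namespace Model

variable {E Ω : Type*} [MeasurableSpace E] [MeasurableSpace Ω]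

/-! ### The value of a pair of Markovian strategies -/

/-- The expected payoff of a pair of Markovian strategies if the game is stopped with payoff `0`
after `n` steps. -/
noncomputable def truncatedValue (D : Model E Ω) (f g h : E → ℝ) (p q : Strategy E) :
    ℕ → E → ℝ
  | 0 => 0
  | n + 1 => fun x => matrixGame (f x) (g x) (h x)
      (D.continuation (D.truncatedValue f g h p q n) x) (p.toFun x) (q.toFun x)

section

variable {D : Model E Ω} {f g h V : E → ℝ}

/-- One Bellman step preserves the bound, because |f| + |g| + |h| plus αΠ of the potential is the
potential again. -/
theorem Dominated.matrixGame (hV : D.Dominated (payoffBound f g h) V)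
    (hb : D.FinitePotential f g h) (p q : Strategy E) :
    D.Dominated (payoffBound f g h) fun x => matrixGame (f x) (g x) (h x)
      (D.continuation V x) (p.toFun x) (q.toFun x) where
  measurable := by
    have h1 := measurable_const (a := (1 : ℝ)) |>.sub p.measurable_toFun
    have h2 := measurable_const (a := (1 : ℝ)) |>.sub q.measurable_toFun
    exact ((((p.measurable_toFun.mul h2).mul hb.measurable_f).add
      ((h1.mul q.measurable_toFun).mul hb.measurable_g)).add
      ((p.measurable_toFun.mul q.measurable_toFun).mul hb.measurable_h)).add
      ((h1.mul h2).mul hV.measurable_continuation)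
  le x := by
    rw [D.potential_eq hb.measurable_payoffBound]
    exact (enorm_matrixGame_le (p.mem_Icc x) (q.mem_Icc x)).trans
      (add_le_add le_rfl (hV.enorm_continuation_le x))

theorem FinitePotential.dominated_truncatedValue (hb : D.FinitePotential f g h)
    (p q : Strategy E) (n : ℕ) :
    D.Dominated (payoffBound f g h) (D.truncatedValue f g h p q n) := by
  induction n with
  | zero => exact ⟨measurable_const, fun x => by simp [truncatedValue]⟩
  | succ n ih => exact ih.matrixGame hb p q

/-- Each Bellman step in the truncated value yields the stage at the current time, and the Markov
property moves the rest one time unit on. Hence N varies in the induction. Before N the strategies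
are arbitrary. -/
theorem FinitePotential.setIntegral_truncatedValue (hb : D.FinitePotential f g h) (x : E)
    {i j : Fin 2} (hij : i ≠ j) (p q : Strategy E) (P Q : ℕ → Strategy E) (n N : ℕ)
    (hP : ∀ k, N ≤ k → P k = p) (hQ : ∀ k, N ≤ k → Q k = q) :
    ∫ ω in {ω | (N : WithTop ℕ) ≤ D.seqTime i P ω ∧ (N : WithTop ℕ) ≤ D.seqTime j Q ω},
        D.α ^ N * D.truncatedValue f g h p q n (D.X N ω) ∂(D.P x)
      = ∑ k ∈ Finset.range n,
          ∫ ω, D.stage f g h (D.seqTime i P) (D.seqTime j Q) (N + k) ω ∂(D.P x) := by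
  induction n generalizing N with
  | zero => simp [truncatedValue]
  | succ n ih =>
    have hd := hb.dominated_truncatedValue p q n
    have h1 := hb.setIntegral_matrixGame (hd.continuation hb) x hij P Q N
    rw [hP N le_rfl, hQ N le_rfl, ← hd.setIntegral_X_succ hb x N (D.measurableSet_lt_stopping
      (D.isStoppingTime_seqTime i P) (D.isStoppingTime_seqTime j Q) N),
      ih (N + 1) (fun k hk => hP k (by omega)) (fun k hk => hQ k (by omega))] at h1
    rw [Finset.sum_range_succ']
    simp only [truncatedValue]
    rw [h1, add_zero, add_comm]
    simp only [add_assoc, add_comm 1]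

theorem setIntegral_zero (hV : Measurable V) (x : E) (τ σ : Ω → WithTop ℕ) :
    ∫ ω in {ω | ((0 : ℕ) : WithTop ℕ) ≤ τ ω ∧ ((0 : ℕ) : WithTop ℕ) ≤ σ ω},
      D.α ^ 0 * V (D.X 0 ω) ∂(D.P x) = V x := by
  have e : {ω | ((0 : ℕ) : WithTop ℕ) ≤ τ ω ∧ ((0 : ℕ) : WithTop ℕ) ≤ σ ω} = Set.univ := by
    ext ω; simp
  rw [e, Measure.restrict_univ, integral_congr_ae (g := fun _ => V x)]
  · simp
  · filter_upwards [D.ae_X_zero x hV] with ω hω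
    simp [hω]

theorem FinitePotential.tendsto_truncatedValue (hb : D.FinitePotential f g h)
    {i j : Fin 2} (hij : i ≠ j) (p q : Strategy E) (x : E) :
    Tendsto (fun n => D.truncatedValue f g h p q n x) atTop
      (𝓝 (∫ ω, D.reward f g h (D.markovTime i p) (D.markovTime j q) ω ∂(D.P x))) := by
  have h1 := (hb.hasSum_integral_stage (D.isStoppingTime_seqTime i fun _ => p)
    (D.isStoppingTime_seqTime j fun _ => q) x).tendsto_sum_nat
  -- `markovTime i p` is by definition `seqTime` of the constant sequence p.
  refine h1.congr fun n => ?_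
  have h2 := hb.setIntegral_truncatedValue x hij p q (fun _ => p) (fun _ => q) n 0
    (fun _ _ => rfl) fun _ _ => rfl
  rw [setIntegral_zero (hb.dominated_truncatedValue p q n).measurable] at h2
  simpa only [zero_add] using h2.symm

/-- Nothing is assumed about measurability of x ↦ `P x`. The value is measurable as a pointwise
limit of Bellman iterates. -/
theorem FinitePotential.dominated_value (hb : D.FinitePotential f g h)
    {i j : Fin 2} (hij : i ≠ j) (p q : Strategy E) :
    D.Dominated (payoffBound f g h) fun x =>
      ∫ ω, D.reward f g h (D.markovTime i p) (D.markovTime j q) ω ∂(D.P x) where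
  measurable := measurable_of_tendsto_metrizable
    (fun n => (hb.dominated_truncatedValue p q n).measurable)
    (tendsto_pi_nhds.2 (hb.tendsto_truncatedValue hij p q))
  le x := hb.enorm_integral_reward_le x

/-- If stationary strategies are used from N on, the rewards from time N on are worth α^N V(X_N) on
survival. This follows by dominated convergence from the truncated identity, with the potential as
majorant. -/
theorem FinitePotential.tendsto_sum_stage (hb : D.FinitePotential f g h) (x : E)
    {i j : Fin 2} (hij : i ≠ j) (p q : Strategy E) (P Q : ℕ → Strategy E) (N : ℕ)
    (hP : ∀ k, N ≤ k → P k = p) (hQ : ∀ k, N ≤ k → Q k = q)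
    (hV : V = fun x => ∫ ω, D.reward f g h (D.markovTime i p) (D.markovTime j q) ω ∂(D.P x)) :
    Tendsto (fun n => ∑ k ∈ Finset.range n,
        ∫ ω, D.stage f g h (D.seqTime i P) (D.seqTime j Q) (N + k) ω ∂(D.P x)) atTop
      (𝓝 (∫ ω in {ω | (N : WithTop ℕ) ≤ D.seqTime i P ω ∧ (N : WithTop ℕ) ≤ D.seqTime j Q ω},
        D.α ^ N * V (D.X N ω) ∂(D.P x))) := by
  have hR : Measurable fun ω => D.potential (payoffBound f g h) (D.X N ω) :=
    (D.measurable_potential hb.measurable_payoffBound).comp (D.measurable_X N)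
  simp only [← hb.setIntegral_truncatedValue x hij p q P Q _ N hP hQ]
  refine tendsto_integral_of_dominated_convergence
    (fun ω => D.α ^ N * (D.potential (payoffBound f g h) (D.X N ω)).toReal) (fun n => ?_) ?_
    (fun n => ae_of_all _ fun ω => ?_) (ae_of_all _ fun ω => ?_)
  · exact (((hb.dominated_truncatedValue p q n).measurable.comp
      (D.measurable_X N)).const_mul _).aestronglyMeasurable
  · exact ((integrable_toReal_of_lintegral_ne_top hR.aemeasurable
      (hb.lintegral_ne_top x N)).const_mul _).integrableOn
  · rw [norm_mul, Real.norm_of_nonneg (pow_nonneg D.α_pos.le N), ← toReal_enorm]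
    exact mul_le_mul_of_nonneg_left (ENNReal.toReal_mono (hb.ne_top _)
      ((hb.dominated_truncatedValue p q n).le _)) (pow_nonneg D.α_pos.le N)
  · rw [hV]
    exact (hb.tendsto_truncatedValue hij p q (D.X N ω)).const_mul _

/-- If Markovian strategies with value function `V` are used from time `1` on, then the expected
reward is the payoff of the matrix game at the initial state with continuation value `αΠV`. -/
theorem FinitePotential.integral_reward_eq_matrixGame (hb : D.FinitePotential f g h) (x : E)
    {i j : Fin 2} (hij : i ≠ j) (p q : Strategy E) (P Q : ℕ → Strategy E)
    (hP : ∀ k, 1 ≤ k → P k = p) (hQ : ∀ k, 1 ≤ k → Q k = q)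
    (hV : V = fun x => ∫ ω, D.reward f g h (D.markovTime i p) (D.markovTime j q) ω ∂(D.P x)) :
    ∫ ω, D.reward f g h (D.seqTime i P) (D.seqTime j Q) ω ∂(D.P x)
      = matrixGame (f x) (g x) (h x) (D.continuation V x) ((P 0).toFun x) ((Q 0).toFun x) := by
  have hτ := D.isStoppingTime_seqTime i P
  have hσ := D.isStoppingTime_seqTime j Q
  have hd : D.Dominated (payoffBound f g h) V := hV ▸ hb.dominated_value hij p q
  have h1 := (hb.hasSum_integral_stage hτ hσ x).tendsto_sum_nat.comp (tendsto_add_atTop_nat 1)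
  have h2 := (hb.tendsto_sum_stage x hij p q P Q 1 hP hQ hV).add_const
    (∫ ω, D.stage f g h (D.seqTime i P) (D.seqTime j Q) 0 ω ∂(D.P x))
  -- The partial sums converge to the full reward and also to stage 0 plus the value of the future.
  have h3 := tendsto_nhds_unique (h1.congr fun n => by
    simp only [Function.comp_apply]
    rw [Finset.sum_range_succ']
    simp only [add_comm _ 1]) h2
  have h4 := hb.setIntegral_matrixGame (hd.continuation hb) x hij P Q 0
  rw [← hd.setIntegral_X_succ hb x 0 (D.measurableSet_lt_stopping hτ hσ 0),
    setIntegral_zero (V := fun y => matrixGame (f y) (g y) (h y) (D.continuation V y)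
      ((P 0).toFun y) ((Q 0).toFun y)) (hd.matrixGame hb (P 0) (Q 0)).measurable] at h4
  rw [h3, h4, add_comm]

/-! ### Verification of pure strategies -/

/-- If the player facing `τ` stops exactly when the process is in a state satisfying `q`, and this
behaviour guarantees `V` in the matrix games with continuation value `αΠV`, then the expected
reward is at most `V`. -/
theorem FinitePotential.integral_reward_le (hb : D.FinitePotential f g h)
    (hV : D.Dominated (payoffBound f g h) V) {τ σ : Ω → WithTop ℕ}
    (hτ : IsStoppingTime D.fullFiltration τ) (hσ : IsStoppingTime D.fullFiltration σ) (x : E)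
    (q : E → Prop)
    (hq : ∀ n : ℕ, ∀ᵐ ω ∂(D.P x), (n : WithTop ℕ) ≤ σ ω → (σ ω = n ↔ q (D.X n ω)))
    (hquit : ∀ y, q y → g y ≤ V y ∧ h y ≤ V y)
    (hcont : ∀ y, ¬ q y → f y ≤ V y ∧ D.continuation V y ≤ V y) :
    ∫ ω, D.reward f g h τ σ ω ∂(D.P x) ≤ V x := by
  set A : ℕ → Set Ω := fun n => {ω | (n : WithTop ℕ) ≤ τ ω ∧ (n : WithTop ℕ) ≤ σ ω} with hA
  have hAm : ∀ n, MeasurableSet (A n) := fun n =>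
    (D.fullFiltration.le n _ (hτ.measurableSet_ge n)).inter
      (D.fullFiltration.le n _ (hσ.measurableSet_ge n))
  -- The supermartingale inequality. After the Markov property replaces αV(Xₙ₊₁) by the continuation
  -- value at Xₙ, it holds pathwise: `hquit` and `hcont` bound the four matrix entries by V.
  have hstep : ∀ n, ∫ ω, D.stage f g h τ σ n ω ∂(D.P x)
      + ∫ ω in A (n + 1), D.α ^ (n + 1) * V (D.X (n + 1) ω) ∂(D.P x)
      ≤ ∫ ω in A n, D.α ^ n * V (D.X n ω) ∂(D.P x) := by
    intro n
    have hα : 0 ≤ D.α ^ n := pow_nonneg D.α_pos.le n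
    have hterm : Integrable
        ((A (n + 1)).indicator fun ω => D.α ^ n * D.continuation V (D.X n ω)) (D.P x) :=
      (((hV.continuation hb).integrable hb x n).const_mul _).indicator (hAm _)
    rw [hV.setIntegral_X_succ hb x n (D.measurableSet_lt_stopping hτ hσ n),
      ← integral_indicator (hAm (n + 1)), ← integral_indicator (hAm n),
      ← integral_add (hb.integrable_stage hτ hσ x n) hterm]
    refine integral_mono_ae ((hb.integrable_stage hτ hσ x n).add hterm)
      (((hV.integrable hb x n).const_mul _).indicator (hAm n)) ?_
    filter_upwards [hq n] with ω hqω
    by_cases hω : ω ∈ A n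
    · have e1 : (n : WithTop ℕ) < τ ω ↔ ¬ τ ω = n :=
        ⟨fun h' => h'.ne', fun h' => lt_of_le_of_ne hω.1 (Ne.symm h')⟩
      have e2 : (n : WithTop ℕ) < σ ω ↔ ¬ σ ω = n :=
        ⟨fun h' => h'.ne', fun h' => lt_of_le_of_ne hω.2 (Ne.symm h')⟩
      have e3 : ω ∈ A (n + 1) ↔ ¬ τ ω = n ∧ ¬ σ ω = n := by
        simp only [hA, Set.mem_ofPred_eq, natCast_succ_le_iff, e1, e2]
      have e4 := hqω hω.2
      by_cases c1 : τ ω = n <;> by_cases c2 : σ ω = n <;>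
        simp [stage, Set.indicator, hω, e1, e2, e3, c1, c2]
      · exact mul_le_mul_of_nonneg_left (hquit _ (e4.1 c2)).2 hα
      · exact mul_le_mul_of_nonneg_left (hcont _ (mt e4.2 c2)).1 hα
      · exact mul_le_mul_of_nonneg_left (hquit _ (e4.1 c2)).1 hα
      · exact mul_le_mul_of_nonneg_left (hcont _ (mt e4.2 c2)).2 hα
    · have h1 : ¬ (τ ω = n ∧ n < σ ω) := fun h' => hω ⟨h'.1.ge, h'.2.le⟩
      have h2 : ¬ (n < τ ω ∧ σ ω = n) := fun h' => hω ⟨h'.1.le, h'.2.ge⟩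
      have h3 : ¬ (τ ω = n ∧ σ ω = n) := fun h' => hω ⟨h'.1.ge, h'.2.ge⟩
      have h4 : ω ∉ A (n + 1) := fun h' =>
        hω ⟨((natCast_succ_le_iff _ _).1 h'.1).le, ((natCast_succ_le_iff _ _).1 h'.2).le⟩
      simp [stage, Set.indicator, hω, h1, h2, h3, h4]
  have hind : ∀ n, ∑ k ∈ Finset.range n, ∫ ω, D.stage f g h τ σ k ω ∂(D.P x)
      + ∫ ω in A n, D.α ^ n * V (D.X n ω) ∂(D.P x) ≤ V x := by
    intro n
    induction n with
    | zero =>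
      rw [Finset.sum_range_zero, zero_add]
      exact (setIntegral_zero hV.measurable x τ σ).le
    | succ n ih =>
      rw [Finset.sum_range_succ]
      linarith [hstep n]
  -- The terminal term vanishes in the limit, so the telescoped bound passes to the full reward.
  have hlim := (hb.hasSum_integral_stage hτ hσ x).tendsto_sum_nat.add
    (hV.tendsto_setIntegral hb x A)
  rw [add_zero] at hlim
  exact le_of_tendsto' hlim hind

end

/-- The pure strategy that stops on a measurable set of states. -/
noncomputable def _root_.DynkinGame.Strategy.ofSet (S : Set E) (hS : MeasurableSet S) :
    Strategy E where
  toFun := S.indicator 1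
  measurable_toFun := measurable_one.indicator hS
  mem_Icc x := by
    simp only [Set.indicator]
    split_ifs <;> simp

theorem _root_.DynkinGame.Strategy.isPure_ofSet (S : Set E) (hS : MeasurableSet S) :
    (Strategy.ofSet S hS).IsPure := by
  intro x
  simp only [Strategy.ofSet, Set.indicator]
  split_ifs <;> simp

/-- Only almost sure: a device equal to 0 would stop a player whose strategy has the value 0, and
one above 1 would block the value 1. -/
theorem ae_markovTime_ofSet (D : Model E Ω) (x : E) (i : Fin 2) (S : Set E)
    (hS : MeasurableSet S) (n : ℕ) :
    ∀ᵐ ω ∂(D.P x), (n : WithTop ℕ) ≤ D.markovTime i (Strategy.ofSet S hS) ω →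
      (D.markovTime i (Strategy.ofSet S hS) ω = n ↔ D.X n ω ∈ S) := by
  have hξ : ∀ᵐ ω ∂(D.P x), D.ξ i n ω ∈ Set.Ioo (0 : ℝ) 1 := by
    refine (ae_map_iff (D.measurable_ξ i n).aemeasurable measurableSet_Ioo).1 ?_
    rw [D.law_ξ]
    exact ae_restrict_mem measurableSet_Ioo
  filter_upwards [hξ] with ω hω hn
  refine (D.seqTime_eq_iff i (fun _ => Strategy.ofSet S hS) hn).trans ?_
  by_cases h : D.X n ω ∈ S <;> simp [Strategy.ofSet, h, hω.1, hω.2.le]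

theorem reward_neg_swap (D : Model E Ω) (f g h : E → ℝ) (τ σ : Ω → WithTop ℕ) (ω : Ω) :
    D.reward (-g) (-f) (-h) σ τ ω = -D.reward f g h τ σ ω := by
  unfold reward
  rcases lt_trichotomy (τ ω) (σ ω) with hlt | heq | hlt
  · simp [hlt, hlt.not_gt]
  · simp only [heq, lt_irrefl, if_false]
    split_ifs <;> simp
  · simp [hlt, hlt.not_gt]

theorem J₂_zeroSum (D : Model E Ω) (f g h : E → ℝ) (x : E) (τ σ : Ω → WithTop ℕ) :
    D.J₂ (zeroSum f g h) x τ σ = -D.J₁ (zeroSum f g h) x τ σ := by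
  rw [J₁, J₂, ← integral_neg]
  exact integral_congr_ae (ae_of_all _ fun ω => D.reward_neg_swap f g h τ σ ω)

/-! ### Equilibria and the matrix games at each state -/

section

variable {D : Model E Ω} {f g h V : E → ℝ}

/-- In an equilibrium the players use optimal strategies of the matrix games with continuation
value `αΠV`. -/
theorem IsGlobalEquilibrium.matrixGame_le {p q : Strategy E}
    (hp : D.IsGlobalEquilibrium (zeroSum f g h) p q) (hb : D.FinitePotential f g h)
    (hV : V = D.value (zeroSum f g h) p q) (x : E) (s : Strategy E) :
    matrixGame (f x) (g x) (h x) (D.continuation V x) (s.toFun x) (q.toFun x) ≤ V x := by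
  have h01 : (0 : Fin 2) ≠ 1 := by decide
  -- A one-shot deviation: s is played at time 0 and the equilibrium strategy afterwards.
  have h1 := hb.integral_reward_eq_matrixGame x h01 p q (fun k => if k = 0 then s else p)
    (fun _ => q) (fun k hk => if_neg (by omega)) (fun _ _ => rfl) hV
  rw [hV] at h1 ⊢
  exact h1.symm.trans_le ((hp x).optimal₁.1 ⟨_, D.seqTime_mem_admissible 0 _, rfl⟩)

theorem IsGlobalEquilibrium.le_matrixGame {p q : Strategy E}
    (hp : D.IsGlobalEquilibrium (zeroSum f g h) p q) (hb : D.FinitePotential f g h)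
    (hV : V = D.value (zeroSum f g h) p q) (x : E) (t : Strategy E) :
    V x ≤ matrixGame (f x) (g x) (h x) (D.continuation V x) (p.toFun x) (t.toFun x) := by
  have h01 : (0 : Fin 2) ≠ 1 := by decide
  have h1 := hb.integral_reward_eq_matrixGame x h01 p q (fun _ => p)
    (fun k => if k = 0 then t else q) (fun _ _ => rfl) (fun k hk => if_neg (by omega)) hV
  rw [hV] at h1 ⊢
  have h2 := (hp x).optimal₂.1 ⟨_, D.seqTime_mem_admissible 1 (fun k => if k = 0 then t else q),
    rfl⟩
  simp only [J₂_zeroSum] at h2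
  exact (neg_le_neg_iff.1 h2).trans_eq h1

/-- Exchanging strategies: J(p₁, p₂) ≤ J(p₁, q₂) ≤ J(q₁, q₂), and symmetrically. -/
theorem IsGlobalEquilibrium.value_eq {p₁ p₂ q₁ q₂ : Strategy E}
    (hp : D.IsGlobalEquilibrium (zeroSum f g h) p₁ p₂)
    (hq : D.IsGlobalEquilibrium (zeroSum f g h) q₁ q₂) :
    D.value (zeroSum f g h) p₁ p₂ = D.value (zeroSum f g h) q₁ q₂ := by
  funext x
  have h1 := (hp x).optimal₁.1 ⟨_, (hq x).admissible₁, rfl⟩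
  have h2 := (hq x).optimal₁.1 ⟨_, (hp x).admissible₁, rfl⟩
  have h3 := (hp x).optimal₂.1 ⟨_, (hq x).admissible₂, rfl⟩
  have h4 := (hq x).optimal₂.1 ⟨_, (hp x).admissible₂, rfl⟩
  simp only [J₂_zeroSum] at h1 h2 h3 h4
  exact le_antisymm ((neg_le_neg_iff.1 h3).trans h2) ((neg_le_neg_iff.1 h4).trans h1)

/-- Stopping sets whose indicators are optimal in the matrix games with continuation value `αΠV`
define an equilibrium. -/
theorem FinitePotential.isGlobalEquilibrium_ofSet (hb : D.FinitePotential f g h)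
    (hV : D.Dominated (payoffBound f g h) V) {S T : Set E} (hS : MeasurableSet S)
    (hT : MeasurableSet T)
    (h1 : ∀ y ∈ S, V y ≤ f y ∧ V y ≤ h y) (h2 : ∀ y ∉ S, V y ≤ g y ∧ V y ≤ D.continuation V y)
    (h3 : ∀ y ∈ T, g y ≤ V y ∧ h y ≤ V y) (h4 : ∀ y ∉ T, f y ≤ V y ∧ D.continuation V y ≤ V y) :
    D.IsGlobalEquilibrium (zeroSum f g h) (Strategy.ofSet S hS) (Strategy.ofSet T hT) := by
  intro x
  set τ := D.markovTime 0 (Strategy.ofSet S hS)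
  set σ := D.markovTime 1 (Strategy.ofSet T hT)
  have hτ : τ ∈ D.admissible 0 := D.seqTime_mem_admissible 0 _
  have hσ : σ ∈ D.admissible 1 := D.seqTime_mem_admissible 1 _
  have hle₁ : ∀ ρ ∈ D.admissible 0, D.J₁ (zeroSum f g h) x ρ σ ≤ V x := fun ρ hρ =>
    hb.integral_reward_le hV (D.isStoppingTime_of_admissible hρ)
      (D.isStoppingTime_of_admissible hσ) x (· ∈ T) (D.ae_markovTime_ofSet x 1 T hT) h3 h4
  -- The same verification in the negated game, where player 2 maximizes against the pure strategy
  -- S.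
  have hle₂ : ∀ ρ ∈ D.admissible 1, D.J₂ (zeroSum f g h) x τ ρ ≤ -V x := fun ρ hρ =>
    hb.neg_swap.integral_reward_le hV.neg (D.isStoppingTime_of_admissible hρ)
      (D.isStoppingTime_of_admissible hτ) x (· ∈ S) (D.ae_markovTime_ofSet x 0 S hS)
      (fun y hy => ⟨neg_le_neg (h1 y hy).1, neg_le_neg (h1 y hy).2⟩)
      (fun y hy => ⟨neg_le_neg (h2 y hy).1, by
        rw [continuation_neg]; exact neg_le_neg (h2 y hy).2⟩)
  have he₁ : D.J₁ (zeroSum f g h) x τ σ = V x := by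
    have := hle₂ σ hσ
    rw [J₂_zeroSum] at this
    exact le_antisymm (hle₁ τ hτ) (neg_le_neg_iff.1 this)
  have he₂ : D.J₂ (zeroSum f g h) x τ σ = -V x := by rw [J₂_zeroSum, he₁]
  refine ⟨hτ, hσ, ⟨?_, fun b hb' => hb' ⟨τ, hτ, rfl⟩⟩, ⟨?_, fun b hb' => hb' ⟨σ, hσ, rfl⟩⟩⟩
  · rintro _ ⟨ρ, hρ, rfl⟩
    exact (hle₁ ρ hρ).trans_eq he₁.symm
  · rintro _ ⟨ρ, hρ, rfl⟩
    exact (hle₂ ρ hρ).trans_eq he₂.symm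

end

end Model

/-! ### Pure solutions of 2 × 2 matrices and the main theorem -/

theorem convex_combination_lt {a b v s : ℝ} (hs : s ∈ Set.Icc (0 : ℝ) 1) (ha : a < v)
    (hb : b < v) : s * a + (1 - s) * b < v := by
  rcases hs.1.eq_or_lt with rfl | h
  · linarith
  · nlinarith [mul_pos h (sub_pos.2 ha), mul_nonneg (sub_nonneg.2 hs.2) (sub_pos.2 hb).le]

/-- If a mixed strategy guarantees `v` to the row player of a `2 × 2` matrix game that has a saddle
point in pure strategies, then so does a pure strategy. -/
theorem exists_pure_row {f g h c v s : ℝ} (hs : s ∈ Set.Icc (0 : ℝ) 1)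
    (h0 : v ≤ s * f + (1 - s) * c) (h1 : v ≤ s * h + (1 - s) * g)
    (h2 : f ⊓ g ≤ h ⊔ c) (h3 : h ⊓ c ≤ f ⊔ g) : (v ≤ f ∧ v ≤ h) ∨ (v ≤ g ∧ v ≤ c) := by
  have hfc : f < v → v ≤ c := fun a => not_lt.1 fun b => h0.not_gt (convex_combination_lt hs a b)
  have hhg : h < v → v ≤ g := fun a => not_lt.1 fun b => h1.not_gt (convex_combination_lt hs a b)
  rw [inf_le_iff, le_sup_iff, le_sup_iff] at h2
  rw [inf_le_iff, le_sup_iff, le_sup_iff] at h3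
  -- Suppose neither row guarantees v. If f < v then c ≥ v, so g < v and h ≥ v, which contradicts
  -- `h3`. If h < v then g ≥ v, so c < v and f ≥ v, which contradicts `h2`.
  grind

end DynkinGame

theorem mainTheorem4 {E Ω : Type*} [MeasurableSpace E] [MeasurableSpace Ω]
    (D : DynkinGame.Model E Ω) (f g h : E → ℝ)
    (hG : D.Standing (DynkinGame.zeroSum f g h))
    (p₁ p₂ : DynkinGame.Strategy E)
    (hp : D.IsGlobalEquilibrium (DynkinGame.zeroSum f g h) p₁ p₂)
    (V : E → ℝ) (hV : V = D.value (DynkinGame.zeroSum f g h) p₁ p₂) :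
    (∃ q₁ q₂ : DynkinGame.Strategy E, q₁.IsPure ∧ q₂.IsPure ∧
        D.IsGlobalEquilibrium (DynkinGame.zeroSum f g h) q₁ q₂) ↔
      ∀ x, h x ⊔ D.continuation V x ≥ f x ⊓ g x ∧ h x ⊓ D.continuation V x ≤ f x ⊔ g x := by
  have hb := hG.finitePotential
  -- Deviating to "continue" or "stop" at time 0 compares V(x) with each row and column of the
  -- matrix.
  let zero := DynkinGame.Strategy.ofSet (∅ : Set E) MeasurableSet.empty
  let one := DynkinGame.Strategy.ofSet (Set.univ : Set E) MeasurableSet.univ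
  have zero_apply : ∀ x, zero.toFun x = 0 := fun x => by simp [zero, DynkinGame.Strategy.ofSet]
  have one_apply : ∀ x, one.toFun x = 1 := fun x => by simp [one, DynkinGame.Strategy.ofSet]
  constructor
  · rintro ⟨q₁, q₂, h₁, h₂, hq⟩ x
    -- The pure equilibrium has the same value V, hence the same matrices.
    have hV' := hV.trans (hp.value_eq hq)
    have r0 := hq.matrixGame_le hb hV' x zero
    have r1 := hq.matrixGame_le hb hV' x one
    have c0 := hq.le_matrixGame hb hV' x zero
    have c1 := hq.le_matrixGame hb hV' x one
    rw [zero_apply] at r0 c0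
    rw [one_apply] at r1 c1
    rw [ge_iff_le, inf_le_iff, le_sup_iff, le_sup_iff, inf_le_iff, le_sup_iff, le_sup_iff]
    -- The chosen cell is a saddle point. At h, for instance, g ≤ h ≤ f, and both inequalities
    -- follow.
    rcases h₁ x with e₁ | e₁ <;> rcases h₂ x with e₂ | e₂ <;>
      simp [DynkinGame.matrixGame, e₁, e₂] at r0 r1 c0 c1 <;> grind
  · intro hx
    have h01 : (0 : Fin 2) ≠ 1 := by decide
    have hd : D.Dominated (DynkinGame.Model.payoffBound f g h) V :=
      hV ▸ hb.dominated_value h01 p₁ p₂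
    have row : ∀ x, (V x ≤ f x ∧ V x ≤ h x) ∨ (V x ≤ g x ∧ V x ≤ D.continuation V x) := by
      intro x
      have c0 := hp.le_matrixGame hb hV x zero
      have c1 := hp.le_matrixGame hb hV x one
      rw [zero_apply] at c0
      rw [one_apply] at c1
      simp only [DynkinGame.matrixGame] at c0 c1
      exact DynkinGame.exists_pure_row (p₁.mem_Icc x) (by linarith) (by linarith) (hx x).1 (hx x).2
    have col : ∀ x, (g x ≤ V x ∧ h x ≤ V x) ∨ (f x ≤ V x ∧ D.continuation V x ≤ V x) := by
      intro x
      have r0 := hp.matrixGame_le hb hV x zero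
      have r1 := hp.matrixGame_le hb hV x one
      rw [zero_apply] at r0
      rw [one_apply] at r1
      simp only [DynkinGame.matrixGame] at r0 r1
      -- The column player is the row player of the negated transpose, which exchanges f and g and
      -- the two conditions.
      have := DynkinGame.exists_pure_row (f := -g x) (g := -f x) (h := -h x)
        (c := -D.continuation V x) (v := -V x) (p₂.mem_Icc x) (by linarith) (by linarith)
        (by rw [← neg_sup, ← neg_inf, neg_le_neg_iff, sup_comm (g x)]; exact (hx x).2)
        (by rw [← neg_sup, ← neg_inf, neg_le_neg_iff, inf_comm (g x)]; exact (hx x).1)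
      simpa only [neg_le_neg_iff] using this
    -- Each player stops exactly where stopping guarantees V. Elsewhere `row` and `col` leave only
    -- continuing.
    refine ⟨_, _, DynkinGame.Strategy.isPure_ofSet _ _, DynkinGame.Strategy.isPure_ofSet _ _,
      hb.isGlobalEquilibrium_ofSet hd (S := {x | V x ≤ f x ∧ V x ≤ h x})
        (T := {x | g x ≤ V x ∧ h x ≤ V x})
        ((measurableSet_le hd.measurable hb.measurable_f).inter
          (measurableSet_le hd.measurable hb.measurable_h))
        ((measurableSet_le hb.measurable_g hd.measurable).inter
          (measurableSet_le hb.measurable_h hd.measurable))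
        (fun y hy => hy) (fun y hy => (row y).resolve_left hy) (fun y hy => hy)
        (fun y hy => (col y).resolve_left hy)⟩
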